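/- There is a subgroup $G$ of $S_\infty$, the group of all permutations of $\mathbb{N}$, which is a maximal cofinitary group and which, regarded as a subset of Baire space ${}^{\mathbb{N}}\mathbb{N}$, is Borel and in fact (lightface) $\Delta^1_1$. Here a subgroup of $S_\infty$ is called cofinitary if each of its non-identity elements has at most finitely many fixed points, and a cofinitary group is maximal if it is not a proper subgroup of another cofinitary group. A subset of ${}^{\mathbb{N}}\mathbb{N}$ is $\Sigma^1_1$ if it is the projection to the first coordinate of an effectively closed ($\Pi^0_1$) subset of ${}^{\mathbb{N}}\mathbb{N}\times{}^{\mathbb{N}}\mathbb{N}$, that is, of the complement of a union of a recursively enumerable family of basic open boxes; it is $\Pi^1_1$ if its complement is $\Sigma^1_1$, and $\Delta^1_1$ if it is both. -/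

import Mathlib

/-- A subgroup of the group of all permutations of `ℕ` is cofinitary if each of its non-identity
elements has only finitely many fixed points. -/
def IsCofinitary (G : Subgroup (Equiv.Perm ℕ)) : Prop :=
  ∀ g ∈ G, g ≠ 1 → {n : ℕ | g n = n}.Finite

/-- A maximal cofinitary group: a cofinitary group that is not a proper subgroup of a
cofinitary group. -/
def IsMaximalCofinitary (G : Subgroup (Equiv.Perm ℕ)) : Prop :=
  Maximal IsCofinitary G

/-- A group of permutations of `ℕ`, regarded as a subset of Baire space. -/
def baireSet (G : Subgroup (Equiv.Perm ℕ)) : Set (ℕ → ℕ) :=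
  {x | ∃ g ∈ G, ∀ n, x n = g n}

/-- The basic open neighbourhood in Baire space given by a finite sequence: all functions that
extend the sequence. -/
def baireCylinder (s : List ℕ) : Set (ℕ → ℕ) :=
  {x | ∀ (i : ℕ) (hi : i < s.length), x i = s[i]}

/-- Lightface `Σ⁰₁` (effectively open) subsets of the product of two copies of Baire space:
unions of a recursively enumerable family of basic open boxes. -/
def IsSigma01 (U : Set ((ℕ → ℕ) × (ℕ → ℕ))) : Prop :=
  ∃ W : Set (List ℕ × List ℕ), REPred (fun c => c ∈ W) ∧
    U = ⋃ c ∈ W, baireCylinder c.1 ×ˢ baireCylinder c.2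

/-- Lightface `Π⁰₁` (effectively closed) subsets of the product of two copies of Baire space. -/
def IsPi01 (F : Set ((ℕ → ℕ) × (ℕ → ℕ))) : Prop :=
  IsSigma01 Fᶜ

/-- Lightface `Σ¹₁` subsets of Baire space: projections of effectively closed sets. -/
def IsSigma11 (A : Set (ℕ → ℕ)) : Prop :=
  ∃ F : Set ((ℕ → ℕ) × (ℕ → ℕ)), IsPi01 F ∧ A = {x | ∃ y, (x, y) ∈ F}

/-- Lightface `Π¹₁` subsets of Baire space: complements of `Σ¹₁` sets. -/
def IsPi11 (A : Set (ℕ → ℕ)) : Prop :=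
  IsSigma11 Aᶜ

/-- Lightface `Δ¹₁` subsets of Baire space. -/
def IsDelta11 (A : Set (ℕ → ℕ)) : Prop :=
  IsSigma11 A ∧ IsPi11 A

/-! The natural numbers form a forest: an odd number is a child of a smaller number along a labelled
edge, and an even number is a root that carries a level. Every infinite binary sequence `a` gives an
involution `gen a`, which matches `n` with its child labelled `a n` wherever this is possible, apart
from exceptional pairs, the sites. These involutions generate `genGroup`. Marks on `a` declare pairs
`(i, v)`, guesses that a permutation to be caught maps `i` to `v`. A declared pair is a site, so
that `gen a i = v`, unless a later declared pair of `a` is coherent with it: both targets descend to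
their sources along the same reduced word.

Catching (`exists_agreement`): if a permutation `h` has finitely many fixed points, some branch
declares infinitely many pairs, all from the graph of `h`. If infinitely many of them are sites,
`gen a` agrees with `h` infinitely often. Otherwise some of them form an infinite coherent chain,
and the common word of the descents is an element of the group that maps their sources to their
targets (`exists_word_of_coherent_chain`). So every permutation agrees infinitely often with a group
element, and a cofinitary group with this property is maximal.

Cofinitariness: a fixed point of a cyclically reduced word is a closed walk. Away from small
vertices such a walk never turns from ascent to descent, so up to reversal it only descends, from
child to predecessor or from source to target. The levels then force a descent from the target of a
site back to its own source. Such loops are bounded for a given word (`exists_loop_bound`), since a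
far larger loop would be coherent with a smaller one, whose pair would then not be a site. Hence
each closed walk meets a bounded vertex (`exists_small_vertex`).

Definability: `gen a` is the only function with certain local properties (`Gen.unique`), so
membership is `Σ¹₁`. A function is outside the group iff it is not a permutation or it differs from
some group element with which it agrees infinitely often. Catching gives one direction and
cofinitariness the other, so the complement is `Σ¹₁` too. -/

/-! ### Binary words coded by numbers -/

/-- `s` is an initial segment of `c`, where a positive number codes the binary word that follows
the leading digit of its binary expansion. -/
def IsPfx (s c : ℕ) : Prop :=
  c / 2 ^ (Nat.log 2 c - Nat.log 2 s) = s

/-- An infinite binary sequence, given by the codes of its initial segments. -/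
structure Branch where
  val : ℕ → ℕ
  val_zero : val 0 = 1
  val_succ : ∀ n, val (n + 1) / 2 = val n

instance : CoeFun Branch fun _ => ℕ → ℕ := ⟨Branch.val⟩

/-- The predecessor of an odd number in the forest of all numbers, whose roots are the even
numbers. -/
def par (y : ℕ) : ℕ := (Nat.unpair (y / 2)).1

/-- The label of the edge from an odd number to its predecessor, and the level of a root. -/
def tag (y : ℕ) : ℕ := if y % 2 = 1 then (Nat.unpair (y / 2)).2 else (Nat.unpair (y / 2)).1

/-- The child of `n` along a branch. -/
def child (a : Branch) (n : ℕ) : ℕ := 2 * Nat.pair n (a n) + 1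

/-- An upper bound for all children of numbers up to `m`. -/
def grow (m : ℕ) : ℕ := 2 * Nat.pair m (2 ^ (m + 1)) + 1

/-- The number of roots of a given level that may be used as sources. -/
def width : ℕ → ℕ
  | 0 => 0
  | l + 1 => grow^[l + 1] (2 * Nat.pair l (width l)) + 1

/-- The pair declared by the last digit of a binary word, its source and its target. -/
def pr (P : ℕ) : ℕ := (Nat.log 2 P - 2) / 2

/-- The source of the pair declared by the last digit of a binary word. -/
def src (P : ℕ) : ℕ := (Nat.unpair (pr P)).1

/-- The target of the pair declared by the last digit of a binary word. -/
def tgt (P : ℕ) : ℕ := (Nat.unpair (pr P)).2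

/-- `v` is a child along every branch through `P`. -/
def IsChildOf (v P : ℕ) : Prop :=
  v % 2 = 1 ∧ Nat.log 2 (tag v) = par v ∧ IsPfx (tag v) P

/-- The last digit of the word is a mark. -/
def Marked (P : ℕ) : Prop := P % 2 = 1 ∧ Nat.log 2 P = 2 * pr P + 2

/-- The last digit of the word `P` declares an admissible pair. -/
structure Decl (P : ℕ) : Prop where
  marked : Marked P
  src_even : src P % 2 = 0
  level_pfx : IsPfx (tag (src P)) P
  index_le : (Nat.unpair (src P / 2)).2 ≤ width (tag (src P))
  width_le : width (tag (src P)) ≤ tgt P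
  ne : src P ≠ tgt P
  not_child : ¬ IsChildOf (tgt P) P
  early : ∀ R < P, IsPfx R P → Marked R → Nat.log 2 R ≤ Nat.log 2 (tag (src P))

/-- Corresponding vertices of two coherent descents. -/
def DescentStep (y y' : ℕ) : Prop :=
  y % 2 = 1 ∧ y' % 2 = 1 ∧ Nat.log 2 (tag y) = par y ∧ IsPfx (tag y) (tag y') ∧
    ¬ IsPfx (tag (par y)) (tag y)

/-- The targets of the declared pairs `P` and `Q` are reached from their sources along the same
reduced word, as far as the labels of the two paths can tell. -/
def Coh (P Q : ℕ) : Prop :=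
  ∃ m < tgt Q + 1, par^[m] (tgt P) = src P ∧ par^[m] (tgt Q) = src Q ∧
    ∀ t < m, DescentStep (par^[t] (tgt P)) (par^[t] (tgt Q)) ∧
      ∀ R < Q, IsPfx R (tag (par^[t] (tgt Q))) → Decl R → tgt R = par (par^[t] (tgt P)) →
        ∃ S, ∃ _ : S < Q, IsPfx S (tag (par^[t] (tgt Q))) ∧ R < S ∧ Decl S ∧ Coh R S
termination_by Q

/-! ### Elementary properties -/

theorem par_odd (n c : ℕ) : par (2 * Nat.pair n c + 1) = n := by
  have : (2 * Nat.pair n c + 1) / 2 = Nat.pair n c := by omega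
  simp [par, this]

theorem tag_odd (n c : ℕ) : tag (2 * Nat.pair n c + 1) = c := by
  have h : (2 * Nat.pair n c + 1) / 2 = Nat.pair n c := by omega
  have h' : (2 * Nat.pair n c + 1) % 2 = 1 := by omega
  simp [tag, h, h']

theorem tag_even (l j : ℕ) : tag (2 * Nat.pair l j) = l := by
  simp [tag]

theorem eq_of_odd {y : ℕ} (h : y % 2 = 1) : y = 2 * Nat.pair (par y) (tag y) + 1 := by
  simp only [par, tag, h, if_true, Nat.pair_unpair]
  omega

theorem eq_of_even {y : ℕ} (h : y % 2 = 0) : y = 2 * Nat.pair (tag y) (Nat.unpair (y / 2)).2 := by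
  have h' : ¬ y % 2 = 1 := by omega
  simp only [tag, h', if_false, Nat.pair_unpair]
  omega

theorem par_le (y : ℕ) : par y ≤ y :=
  (Nat.unpair_left_le _).trans (Nat.div_le_self _ _)

theorem tag_le (y : ℕ) : tag y ≤ y := by
  unfold tag
  split
  · exact (Nat.unpair_right_le _).trans (Nat.div_le_self _ _)
  · exact (Nat.unpair_left_le _).trans (Nat.div_le_self _ _)

theorem par_iterate_le (t y : ℕ) : par^[t] y ≤ y := by
  induction t with
  | zero => exact le_rfl
  | succ t ih => rw [Function.iterate_succ_apply']; exact (par_le _).trans ih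

theorem IsPfx.le {s c : ℕ} (h : IsPfx s c) : s ≤ c := by
  rw [← h]; exact Nat.div_le_self _ _

namespace Branch

variable (a b : Branch)

theorem two_pow_le (n : ℕ) : 2 ^ n ≤ a n := by
  induction n with
  | zero => simp [a.val_zero]
  | succ n ih => have := a.val_succ n; rw [pow_succ]; omega

theorem lt_two_pow (n : ℕ) : a n < 2 ^ (n + 1) := by
  induction n with
  | zero => simp [a.val_zero]
  | succ n ih => have := a.val_succ n; rw [pow_succ]; omega

@[simp] theorem log_val (n : ℕ) : Nat.log 2 (a n) = n :=
  Nat.log_eq_of_pow_le_of_lt_pow (a.two_pow_le n) (a.lt_two_pow n)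

theorem lt_val (n : ℕ) : n < a n := n.lt_two_pow_self.trans_le (a.two_pow_le n)

theorem val_div (n q : ℕ) : a n / 2 ^ q = a (n - q) ∨ n < q := by
  induction q with
  | zero => simp
  | succ q ih =>
    rcases ih with h | h
    · by_cases hq : n ≤ q
      · right; omega
      · left
        rw [pow_succ, ← Nat.div_div_eq_div_mul, h]
        have := a.val_succ (n - (q + 1))
        rwa [show n - (q + 1) + 1 = n - q by omega] at this
    · right; omega

theorem isPfx_iff {s n : ℕ} : IsPfx s (a n) ↔ Nat.log 2 s ≤ n ∧ a (Nat.log 2 s) = s := by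
  unfold IsPfx
  rw [log_val]
  rcases a.val_div n (n - Nat.log 2 s) with h | h
  · rw [h]
    rcases le_or_gt (Nat.log 2 s) n with h' | h'
    · rw [Nat.sub_sub_self h']; simp [h']
    · rw [show n - (n - Nat.log 2 s) = n by omega]
      constructor
      · intro hs; rw [← hs, log_val] at h'; omega
      · intro hs; omega
  · omega

theorem isPfx_val {k n : ℕ} (h : k ≤ n) : IsPfx (a k) (a n) := by
  rw [isPfx_iff]; simp [h]

theorem strictMono : StrictMono a.val := by
  refine strictMono_nat_of_lt_succ fun n => ?_
  have := a.val_succ n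
  have := a.lt_val n
  omega

theorem eq_of_val_le {a b : Branch} {k n : ℕ} (h : k ≤ n) (hn : a n = b n) : a k = b k := by
  have h1 := a.isPfx_val h
  rw [hn, isPfx_iff] at h1
  simpa using h1.2.symm

theorem ext' {a b : Branch} (h : ∀ n, a n = b n) : a = b := by
  cases a; cases b; congr; exact funext h

theorem exists_ne {a b : Branch} (h : a ≠ b) : ∃ K, ∀ n ≥ K, a n ≠ b n := by
  by_contra! hc
  exact h (ext' fun n => by
    obtain ⟨k, hk, e⟩ := hc n
    exact eq_of_val_le hk e)

end Branch

/-! ### Children and the growth of `width`. -/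

theorem child_lt (a : Branch) (n : ℕ) : n < child a n := by
  have := Nat.left_le_pair n (a n)
  unfold child; omega

theorem child_odd (a : Branch) (n : ℕ) : child a n % 2 = 1 := by
  unfold child; omega

@[simp] theorem par_child (a : Branch) (n : ℕ) : par (child a n) = n := par_odd _ _

@[simp] theorem tag_child (a : Branch) (n : ℕ) : tag (child a n) = a n := tag_odd _ _

theorem pair_le_pair {a b c d : ℕ} (h : a ≤ c) (h' : b ≤ d) : Nat.pair a b ≤ Nat.pair c d := by
  have h1 : Nat.pair a b ≤ Nat.pair c b := by
    rcases h.eq_or_lt with rfl | h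
    · exact le_rfl
    · exact (Nat.pair_lt_pair_left b h).le
  have h2 : Nat.pair c b ≤ Nat.pair c d := by
    rcases h'.eq_or_lt with rfl | h
    · exact le_rfl
    · exact (Nat.pair_lt_pair_right c h).le
  exact h1.trans h2

theorem grow_mono : Monotone grow := by
  intro m n h
  have := pair_le_pair h (Nat.pow_le_pow_right two_pos (Nat.succ_le_succ h))
  simpa [grow] using this

theorem lt_grow (m : ℕ) : m < grow m := by
  have := Nat.left_le_pair m (2 ^ (m + 1))
  unfold grow; omega

theorem child_le_grow (a : Branch) (n : ℕ) : child a n ≤ grow n := by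
  have := pair_le_pair (le_refl n) (a.lt_two_pow n).le
  unfold grow child; omega

theorem grow_iterate_mono {d e m n : ℕ} (hd : d ≤ e) (h : m ≤ n) : grow^[d] m ≤ grow^[e] n :=
  ((grow_mono.iterate d) h).trans (Function.monotone_iterate_of_id_le (fun m => (lt_grow m).le) hd n)

theorem width_mono : StrictMono width := by
  refine strictMono_nat_of_lt_succ fun l => ?_
  have h1 := Nat.right_le_pair l (width l)
  have h2 : _ ≤ grow^[l + 1] (2 * Nat.pair l (width l)) := grow_iterate_mono (Nat.zero_le _) le_rfl
  simp only [Function.iterate_zero, id] at h2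
  simp only [width]
  omega

theorem le_width (l : ℕ) : l ≤ width l := width_mono.le_apply

/-- The recursion for `width` is chosen for this bound. Since the target of a pair with source level
`l` is at least `width l`, a descent of at most `l` steps from it cannot end in an admissible source
of lower level. -/
theorem grow_iterate_lt_width {l l' j d : ℕ} (hl : l' < l) (hj : j ≤ width l') (hd : d ≤ l) :
    grow^[d] (2 * Nat.pair l' j) < width l := by
  obtain ⟨l, rfl⟩ : ∃ k, l = k + 1 := ⟨l - 1, by omega⟩
  have h1 : l' ≤ l := by omega
  have := pair_le_pair h1 (hj.trans (width_mono.monotone h1))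
  have := grow_iterate_mono hd (show 2 * Nat.pair l' j ≤ 2 * Nat.pair l (width l) by omega)
  simp only [width]
  omega

/-! ### Marked and declared words on branches -/

theorem Marked.branch_eq {P : ℕ} (h : Marked P) : Nat.log 2 P = 2 * Nat.pair (src P) (tgt P) + 2 := by
  rw [h.2, src, tgt, Nat.pair_unpair]

theorem pr_branch (a : Branch) (i v : ℕ) : pr (a (2 * Nat.pair i v + 2)) = Nat.pair i v := by
  simp [pr]

@[simp] theorem src_branch (a : Branch) (i v : ℕ) : src (a (2 * Nat.pair i v + 2)) = i := by
  rw [src, pr_branch, Nat.unpair_pair]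

@[simp] theorem tgt_branch (a : Branch) (i v : ℕ) : tgt (a (2 * Nat.pair i v + 2)) = v := by
  rw [tgt, pr_branch, Nat.unpair_pair]

theorem tgt_lt {Q : ℕ} (hQ : Q ≠ 0) : tgt Q < Q := by
  have h1 : tgt Q ≤ pr Q := Nat.unpair_right_le _
  have h2 : pr Q ≤ Nat.log 2 Q := by unfold pr; omega
  have h3 := Nat.log_lt_self 2 hQ
  omega

/-- The pair `(i, v)` is declared on the branch `a`. -/
def DeclOn (a : Branch) (i v : ℕ) : Prop := Decl (a (2 * Nat.pair i v + 2))

/-- The pair `(i, v)` is declared on `a` and no pair declared later on is coherent with it. -/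
def Site (a : Branch) (i v : ℕ) : Prop :=
  DeclOn a i v ∧ ∀ n > 2 * Nat.pair i v + 2, Decl (a n) → ¬ Coh (a (2 * Nat.pair i v + 2)) (a n)

namespace DeclOn

variable {a : Branch} {i v i' v' : ℕ}

theorem even (h : DeclOn a i v) : i % 2 = 0 := by simpa using Decl.src_even h

theorem eq_pair (h : DeclOn a i v) : i = 2 * Nat.pair (tag i) (Nat.unpair (i / 2)).2 := eq_of_even h.even

theorem level (h : DeclOn a i v) : a (Nat.log 2 (tag i)) = tag i := by
  have := Decl.level_pfx h
  rw [src_branch, Branch.isPfx_iff] at this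
  exact this.2

theorem index_le (h : DeclOn a i v) : (Nat.unpair (i / 2)).2 ≤ width (tag i) := by
  simpa using Decl.index_le h

theorem width_le (h : DeclOn a i v) : width (tag i) ≤ v := by simpa using Decl.width_le h

theorem ne (h : DeclOn a i v) : i ≠ v := by simpa using Decl.ne h

theorem src_ne_child (h : DeclOn a i v) (b : Branch) (n : ℕ) : i ≠ child b n := by
  rintro rfl
  have := h.even
  have := child_odd b n
  omega

theorem src_le (h : DeclOn a i v) : i ≤ 2 * Nat.pair v v := by
  rw [h.eq_pair]
  have h1 := (le_width (tag i)).trans h.width_le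
  have := pair_le_pair h1 (h.index_le.trans h.width_le)
  omega

/-- The declaring word is longer than the target, so it already decides whether the target is a
child along the branch. -/
theorem tgt_ne_child (h : DeclOn a i v) (n : ℕ) : v ≠ child a n := by
  rintro rfl
  apply Decl.not_child h
  rw [tgt_branch]
  refine ⟨child_odd _ _, by simp, ?_⟩
  rw [tag_child]
  apply Branch.isPfx_val
  have := child_lt a n
  have := Nat.right_le_pair i (child a n)
  omega

/-- By `early`, all earlier marks lie inside the level of the new source. So each new source exceeds
everything declared before, and the declared pairs of one branch are disjoint. -/
theorem lt_level (h : DeclOn a i v) (h' : DeclOn a i' v') (hlt : Nat.pair i v < Nat.pair i' v') :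
    2 * Nat.pair i v + 2 ≤ Nat.log 2 (tag i') := by
  have := Decl.early h' (a (2 * Nat.pair i v + 2)) (a.strictMono (by omega))
    (a.isPfx_val (by omega)) h.marked
  simpa using this

theorem pair_lt_tag (h : DeclOn a i v) (h' : DeclOn a i' v') (hlt : Nat.pair i v < Nat.pair i' v') :
    Nat.pair i v < tag i' := by
  have h1 := h.lt_level h' hlt
  rcases eq_or_ne (tag i') 0 with h0 | h0
  · simp [h0] at h1
  · have := Nat.log_lt_self 2 h0
    omega

theorem tgt_lt_src (h : DeclOn a i v) (h' : DeclOn a i' v') (hlt : Nat.pair i v < Nat.pair i' v') :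
    v < i' :=
  ((Nat.right_le_pair i v).trans_lt (h.pair_lt_tag h' hlt)).trans_le (tag_le _)

theorem endpoints_lt (h : DeclOn a i v) (h' : DeclOn a i' v')
    (hlt : Nat.pair i v < Nat.pair i' v') : i < i' ∧ v < i' ∧ i < v' ∧ v < v' := by
  have h1 := h.pair_lt_tag h' hlt
  have h2 := Nat.right_le_pair i v
  have h3 := Nat.left_le_pair i v
  have h4 := tag_le i'
  have h5 := (le_width (tag i')).trans h'.width_le
  omega

theorem eq_of_meet (h : DeclOn a i v) (h' : DeclOn a i' v')
    (hm : i = i' ∨ v = i' ∨ i = v' ∨ v = v') : i = i' ∧ v = v' := by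
  rcases lt_trichotomy (Nat.pair i v) (Nat.pair i' v') with hlt | heq | hlt
  · have := h.endpoints_lt h' hlt; omega
  · simpa using heq
  · have := h'.endpoints_lt h hlt; omega

theorem eq_of_level_eq (h : DeclOn a i v) (h' : DeclOn a i' v') (hl : tag i = tag i') :
    i = i' ∧ v = v' := by
  rcases lt_trichotomy (Nat.pair i v) (Nat.pair i' v') with hlt | heq | hlt
  · have := h.pair_lt_tag h' hlt
    have := tag_le i
    have := Nat.left_le_pair i v
    omega
  · simpa using heq
  · have := h'.pair_lt_tag h hlt
    have := tag_le i'
    have := Nat.left_le_pair i' v'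
    omega

end DeclOn

/-! ### The generators -/

/-- The involution `g` realizes the branch `a`: it exchanges the endpoints of the sites of `a` and
matches all other vertices along edges of the forest. -/
structure Gen (a : Branch) (g : ℕ → ℕ) : Prop where
  invol : ∀ x, g (g x) = x
  site : ∀ x y, Site a x y → g x = y
  cases : ∀ x, Site a x (g x) ∨ Site a (g x) x ∨ g x = child a x ∨ x = child a (g x)

/-- `x` is an endpoint of a site of `a`. -/
def IsEnd (a : Branch) (x : ℕ) : Prop := ∃ y, Site a x y ∨ Site a y x

theorem not_isEnd_child (a : Branch) (n : ℕ) : ¬ IsEnd a (child a n) := by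
  rintro ⟨y, h | h⟩
  · exact h.1.src_ne_child a n rfl
  · exact h.1.tgt_ne_child n rfl

theorem child_injective (a : Branch) : Function.Injective (child a) := fun x y h => by
  simpa using congrArg par h

namespace Gen

variable {a : Branch} {g g' : ℕ → ℕ}

theorem site' (h : Gen a g) {x y : ℕ} (hs : Site a y x) : g x = y := by
  rw [← h.site y x hs, h.invol]

/-- Sites are forced. Otherwise a disagreement at `x` means that one involution moves `x` to its
child and the other to its predecessor; at the predecessor both agree by induction, and being
involutions they agree at `x`. -/
theorem unique (h : Gen a g) (h' : Gen a g') : g = g' := by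
  have key : ∀ x, g x = g' x := by
    intro x
    induction x using Nat.strong_induction_on with
    | _ x ih =>
      rcases h.cases x with e | e | e | e
      · exact (h'.site _ _ e).symm
      · exact (h'.site' e).symm
      · rcases h'.cases x with e' | e' | e' | e'
        · exact h.site _ _ e'
        · exact h.site' e'
        · rw [e, e']
        · have hlt : g' x < x := by have := child_lt a (g' x); omega
          have := ih _ hlt
          rw [h'.invol] at this
          have h2 := h.invol (g' x)
          rw [this] at h2
          exact h2
      · have hlt : g x < x := by have := child_lt a (g x); omega
        have := ih _ hlt
        rw [h.invol] at this
        have h2 := h'.invol (g x)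
        rw [← this] at h2
        exact h2.symm
  exact funext key

theorem ne (h : Gen a g) (x : ℕ) : g x ≠ x := by
  intro hx
  rcases h.cases x with e | e | e | e <;> rw [hx] at e
  · exact e.1.ne rfl
  · exact e.1.ne rfl
  · exact (child_lt a x).ne e
  · exact (child_lt a x).ne e

end Gen

/-- `x` is matched with its predecessor. -/
def IsDown (a : Branch) (x : ℕ) : Prop :=
  ∃ n, ∃ _ : n < x, x = child a n ∧ ¬ IsEnd a n ∧ ¬ IsDown a n
termination_by x

theorem isDown_child {a : Branch} {n : ℕ} : IsDown a (child a n) ↔ ¬ IsEnd a n ∧ ¬ IsDown a n := by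
  rw [IsDown]
  constructor
  · rintro ⟨m, hm, h, h'⟩
    rwa [child_injective a h]
  · exact fun h => ⟨n, child_lt a n, rfl, h⟩

theorem IsDown.eq {a : Branch} {x : ℕ} (h : IsDown a x) : x = child a (par x) := by
  rw [IsDown] at h
  obtain ⟨n, -, h, -⟩ := h
  rw [h, par_child]

open Classical in
/-- The involution that realizes a branch. -/
noncomputable def mate (a : Branch) (x : ℕ) : ℕ :=
  if h : IsEnd a x then h.choose else if IsDown a x then par x else child a x

theorem Site.eq_of_meet {a : Branch} {i v i' v' : ℕ} (h : Site a i v) (h' : Site a i' v')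
    (hm : i = i' ∨ v = i' ∨ i = v' ∨ v = v') : i = i' ∧ v = v' :=
  h.1.eq_of_meet h'.1 hm

theorem mate_of_site {a : Branch} {x y : ℕ} (h : Site a x y ∨ Site a y x) : mate a x = y := by
  have hx : IsEnd a x := ⟨y, h⟩
  have hs := hx.choose_spec
  rw [mate, dif_pos hx]
  rcases h with h | h <;> rcases hs with hs | hs
  · exact (hs.eq_of_meet h (by simp)).2
  · have := hs.eq_of_meet h (by simp); omega
  · have := hs.eq_of_meet h (by simp); omega
  · exact (hs.eq_of_meet h (by simp)).1

theorem gen_mate (a : Branch) : Gen a (mate a) := by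
  have up {x : ℕ} (h : ¬ IsEnd a x) (h' : ¬ IsDown a x) : mate a x = child a x := by
    rw [mate, dif_neg h, if_neg h']
  have down {x : ℕ} (h : IsDown a x) : mate a x = par x := by
    have : ¬ IsEnd a x := by rw [h.eq]; exact not_isEnd_child a _
    rw [mate, dif_neg this, if_pos h]
  have up' {x : ℕ} (h : ¬ IsEnd a x) (h' : ¬ IsDown a x) : mate a (child a x) = x := by
    rw [down (isDown_child.2 ⟨h, h'⟩), par_child]
  refine ⟨fun x => ?_, fun x y h => mate_of_site (.inl h), fun x => ?_⟩
  · by_cases h : IsEnd a x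
    · obtain ⟨y, hy⟩ := h
      rw [mate_of_site hy, mate_of_site hy.symm]
    · by_cases h' : IsDown a x
      · obtain ⟨h1, h2⟩ := isDown_child.1 (h'.eq ▸ h')
        rw [down h', up h1 h2, ← h'.eq]
      · rw [up h h', up' h h']
  · by_cases h : IsEnd a x
    · obtain ⟨y, hy⟩ := h
      rw [mate_of_site hy]
      tauto
    · by_cases h' : IsDown a x
      · exact .inr (.inr (.inr (by rw [down h']; exact h'.eq)))
      · exact .inr (.inr (.inl (up h h')))

theorem mate_mate (a : Branch) (x : ℕ) : mate a (mate a x) = x := (gen_mate a).invol x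

/-- The permutation that realizes a branch. -/
noncomputable def gen (a : Branch) : Equiv.Perm ℕ :=
  ⟨mate a, mate a, mate_mate a, mate_mate a⟩

@[simp] theorem gen_apply (a : Branch) (x : ℕ) : gen a x = mate a x := rfl

@[simp] theorem gen_inv (a : Branch) : (gen a)⁻¹ = gen a := rfl

@[simp] theorem gen_mul_self (a : Branch) : gen a * gen a = 1 := by
  ext x; simp [mate_mate]

/-- The product of the generators along a word. -/
noncomputable def wordProd (L : List Branch) : Equiv.Perm ℕ := (L.map gen).prod

@[simp] theorem wordProd_nil : wordProd [] = 1 := rfl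

@[simp] theorem wordProd_cons (a : Branch) (L : List Branch) :
    wordProd (a :: L) = gen a * wordProd L := by
  simp [wordProd]

@[simp] theorem wordProd_append (L L' : List Branch) :
    wordProd (L ++ L') = wordProd L * wordProd L' := by
  simp [wordProd]

/-- The group generated by all realizations of branches. -/
noncomputable def genGroup : Subgroup (Equiv.Perm ℕ) := Subgroup.closure (Set.range gen)

theorem mem_genGroup {g : Equiv.Perm ℕ} : g ∈ genGroup ↔ ∃ L, g = wordProd L := by
  constructor
  · intro h
    induction h using Subgroup.closure_induction with
    | mem x hx => obtain ⟨a, rfl⟩ := hx; exact ⟨[a], by simp⟩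
    | one => exact ⟨[], rfl⟩
    | mul x y _ _ hx hy =>
      obtain ⟨L, rfl⟩ := hx
      obtain ⟨L', rfl⟩ := hy
      exact ⟨L ++ L', by simp⟩
    | inv x _ hx =>
      obtain ⟨L, rfl⟩ := hx
      refine ⟨L.reverse, ?_⟩
      clear * -
      induction L with
      | nil => simp
      | cons a L ih => simp [ih]
  · rintro ⟨L, rfl⟩
    induction L with
    | nil => exact one_mem _
    | cons a L ih =>
      rw [wordProd_cons]
      exact mul_mem (Subgroup.subset_closure ⟨a, rfl⟩) ih

/-! ### Closed walks -/

theorem Decl.declOn_of_isPfx {a : Branch} {R k : ℕ} (h : Decl R) (hp : IsPfx R (a k)) :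
    DeclOn a (src R) (tgt R) ∧ R = a (2 * Nat.pair (src R) (tgt R) + 2) := by
  rw [Branch.isPfx_iff] at hp
  have h1 := hp.2
  rw [h.marked.branch_eq] at h1
  exact ⟨by rw [DeclOn, h1]; exact h, h1.symm⟩

/-- At most one pair with target `n` is declared on `a`. It is not a site, so a later coherent pair
exists, and every sufficiently long initial segment shows it. This supplies the last clause of
`Coh`. -/
theorem eventually_killed {a : Branch} {n : ℕ} (h : ¬ IsEnd a n) :
    ∀ᶠ k in Filter.atTop, ∀ R, IsPfx R (a k) → Decl R → tgt R = n →
      ∃ S, IsPfx S (a k) ∧ R < S ∧ Decl S ∧ Coh R S := by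
  by_cases hd : ∃ i, DeclOn a i n
  · obtain ⟨i, hi⟩ := hd
    have hs : ¬ Site a i n := fun hs => h ⟨i, .inr hs⟩
    have : ∃ k > 2 * Nat.pair i n + 2, Decl (a k) ∧ Coh (a (2 * Nat.pair i n + 2)) (a k) := by
      by_contra! hc
      exact hs ⟨hi, hc⟩
    obtain ⟨k, hk, hdk, hc⟩ := this
    filter_upwards [Filter.eventually_ge_atTop k] with q hq R hp hR ht
    obtain ⟨h1, h2⟩ := hR.declOn_of_isPfx hp
    obtain ⟨h3, h4⟩ := h1.eq_of_meet hi (.inr (.inr (.inr ht)))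
    rw [h3, h4] at h2
    exact ⟨a k, a.isPfx_val hq, h2 ▸ a.strictMono hk, hdk, h2 ▸ hc⟩
  · refine Filter.Eventually.of_forall fun k R hp hR ht => ?_
    exact absurd ⟨_, ht ▸ (hR.declOn_of_isPfx hp).1⟩ hd

/-- From the target of the site `(i, v)` of `b`, one descends to its source along `α`. -/
structure IsLoop (b : Branch) (α : ℕ → Branch) (d K i v : ℕ) : Prop where
  site : Site b i v
  level : K ≤ Nat.log 2 (tag i)
  closed : par^[d] v = i
  step : ∀ t < d, par^[t] v = child (α t) (par^[t + 1] v)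
  not_isEnd : ∀ t < d, ¬ IsEnd (α t) (par^[t + 1] v)
  large : ∀ t < d, K ≤ par^[t + 1] v

theorem par_iterate_le_of_le {s t : ℕ} (h : s ≤ t) (v : ℕ) : par^[t] v ≤ par^[s] v := by
  obtain ⟨e, rfl⟩ := Nat.exists_eq_add_of_le' h
  rw [Function.iterate_add_apply]
  exact par_iterate_le _ _

/-- Of two loops along `α`, the second far above the first, the labels of the second extend those of
the first; `hα` and `hb` make the descent reduced. The pairs are then coherent, so the first is not
a site. -/
theorem exists_loop_bound (b : Branch) (α : ℕ → Branch) (d K : ℕ)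
    (hα : ∀ t, t + 1 < d → ∀ n ≥ K, α t n ≠ α (t + 1) n)
    (hb : ∀ t, t + 1 = d → ∀ n ≥ K, α t n ≠ b n) :
    ∃ M, ∀ i v, IsLoop b α d K i v → i ≤ M := by
  by_contra! hc
  obtain ⟨i, v, h, -⟩ := hc 0
  have hk : ∀ᶠ k in Filter.atTop, ∀ t ∈ Finset.range d, ∀ R, IsPfx R (α t k) → Decl R →
      tgt R = par^[t + 1] v → ∃ S, IsPfx S (α t k) ∧ R < S ∧ Decl S ∧ Coh R S :=
    (Filter.eventually_all_finset _).2 fun t ht =>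
      eventually_killed (h.not_isEnd t (Finset.mem_range.1 ht))
  obtain ⟨B, hB⟩ := Filter.eventually_atTop.1 hk
  -- The second loop has labels of length at least `B`, and its pair is declared after `(i, v)`.
  obtain ⟨i', v', h', hi'⟩ := hc (B + d + Nat.pair i v)
  have hle : ∀ t ≤ d, i' ≤ par^[t] v' := fun t ht => by
    rw [← h'.closed]; exact par_iterate_le_of_le ht v'
  have hv' : i' ≤ v' := hle 0 (Nat.zero_le _)
  have hlt : Nat.pair i v < Nat.pair i' v' := by
    have := Nat.left_le_pair i' v'; omega
  have hvi : v < i' := h.site.1.tgt_lt_src h'.site.1 hlt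
  refine h.site.2 (2 * Nat.pair i' v' + 2) (by omega) h'.site.1 ?_
  rw [Coh]
  have htag : ∀ t < d, tag (par^[t] v) = α t (par^[t + 1] v) := fun t ht => by
    rw [h.step t ht, tag_child]
  have htag' : ∀ t < d, tag (par^[t] v') = α t (par^[t + 1] v') := fun t ht => by
    rw [h'.step t ht, tag_child]
  simp only [src_branch, tgt_branch]
  refine ⟨d, by omega, h.closed, h'.closed, fun t ht => ⟨⟨?_, ?_, ?_, ?_, ?_⟩, ?_⟩⟩
  · rw [h.step t ht]; exact child_odd _ _
  · rw [h'.step t ht]; exact child_odd _ _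
  · rw [htag t ht, Branch.log_val, Function.iterate_succ_apply']
  · rw [htag t ht, htag' t ht]
    apply Branch.isPfx_val
    exact ((par_iterate_le _ _).trans hvi.le).trans (hle _ ht)
  · have hl := h.large t ht
    rw [htag t ht, ← Function.iterate_succ_apply' par t v, Branch.isPfx_iff]
    rintro ⟨-, h2⟩
    rcases Nat.lt_or_ge (t + 1) d with h3 | h3
    · rw [htag (t + 1) h3, Branch.log_val] at h2
      exact hα t h3 _ (h.large (t + 1) h3) h2
    · have h4 : t + 1 = d := by omega
      rw [Nat.succ_eq_add_one, h4, h.closed] at h2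
      exact hb t h4 _ h.level (h2.trans h.site.1.level.symm)
  · intro R _ hp hR hRt
    rw [← Function.iterate_succ_apply' par t v] at hRt
    have hBt : B ≤ par^[t + 1] v' := (by omega : B ≤ i').trans (hle _ ht)
    rw [htag' t ht] at hp ⊢
    obtain ⟨S, h1, h2, h3, h4⟩ := hB _ hBt t (Finset.mem_range.2 ht) R hp hR hRt
    refine ⟨S, ?_, h1, h2, h3, h4⟩
    have h5 := h1.le
    rw [← htag' t ht] at h5
    have h6 := tgt_lt (Q := b (2 * Nat.pair i' v' + 2)) (by have := b.lt_val (2 * Nat.pair i' v' + 2); omega)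
    rw [tgt_branch] at h6
    exact ((h5.trans (tag_le _)).trans (par_iterate_le _ _)).trans_lt h6

theorem descent {d : ℕ} {y : ℕ → ℕ} {α : ℕ → Branch} (h : ∀ t < d, y t = child (α t) (y (t + 1))) :
    y 0 ≤ grow^[d] (y d) ∧ ∀ t ≤ d, par^[t] (y 0) = y t := by
  induction d with
  | zero => simp
  | succ d ih =>
    obtain ⟨h1, h2⟩ := ih fun t ht => h t (by omega)
    have hd := h d (by omega)
    constructor
    · refine h1.trans ?_
      rw [Function.iterate_succ_apply, hd]
      exact (grow_mono.iterate d) (child_le_grow _ _)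
    · intro t ht
      rcases Nat.lt_or_ge t (d + 1) with h' | h'
      · exact h2 t (by omega)
      · obtain rfl : t = d + 1 := by omega
        rw [Function.iterate_succ_apply', h2 d le_rfl, hd, par_child]

theorem lt_tag_of_lt {l i : ℕ} (he : i = 2 * Nat.pair (tag i) (Nat.unpair (i / 2)).2)
    (hj : (Nat.unpair (i / 2)).2 ≤ width (tag i)) (h : 2 * Nat.pair l (width l) < i) : l < tag i := by
  by_contra! hc
  have := pair_le_pair hc (hj.trans (width_mono.monotone hc))
  omega

theorem mod_eq {α : Type*} {f : ℕ → α} {m : ℕ} (h : ∀ r, f (r + m) = f r) (r : ℕ) : f (r % m) = f r :=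
  (Function.Periodic.map_mod_nat (f := f) h r)

/-- The words of a periodic sequence of branches are eventually distinguished. -/
theorem exists_separation {a : ℕ → Branch} {m : ℕ} (hm : 0 < m) (per : ∀ r, a (r + m) = a r) :
    ∃ K, ∀ r r', a r ≠ a r' → ∀ n ≥ K, a r n ≠ a r' n := by
  have : ∀ᶠ K in Filter.atTop, ∀ r ∈ Finset.range m, ∀ r' ∈ Finset.range m, a r ≠ a r' →
      ∀ n ≥ K, a r n ≠ a r' n := by
    refine (Filter.eventually_all_finset _).2 fun r _ => (Filter.eventually_all_finset _).2 fun r' _ => ?_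
    by_cases h : a r = a r'
    · exact Filter.Eventually.of_forall fun K h' => absurd h h'
    · obtain ⟨K, hK⟩ := Branch.exists_ne h
      filter_upwards [Filter.eventually_ge_atTop K] with K' h' _ n hn
      exact hK n (h'.trans hn)
  obtain ⟨K, hK⟩ := this.exists
  refine ⟨K, fun r r' h n hn => ?_⟩
  have h1 := hK (r % m) (Finset.mem_range.2 (Nat.mod_lt _ hm)) (r' % m)
    (Finset.mem_range.2 (Nat.mod_lt _ hm))
  rw [mod_eq per, mod_eq per] at h1
  exact h1 h n hn

theorem two_pow_lt_log {K l : ℕ} (h : 2 ^ K < l) : K ≤ Nat.log 2 l :=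
  Nat.le_log_of_pow_le (by norm_num) h.le

/-- A closed walk cannot descend by child edges alone, so it uses a site. Starting from a site of
maximal level, the walk descends from its target to the source of the next site, which turns out to
be the same pair on the same branch: a loop, hence bounded. -/
theorem no_descending_walk {a : ℕ → Branch} {m : ℕ} (hm : 0 < m) (per : ∀ r, a (r + m) = a r)
    (red : ∀ r, a (r + 1) ≠ a r) :
    ∃ M, ∀ x : ℕ → ℕ, (∀ r, x (r + m) = x r) → (∀ r, mate (a r) (x r) = x (r + 1)) →
      (∀ r, M < x r) → ¬ ∀ r, x r = child (a r) (x (r + 1)) ∨ Site (a r) (x r) (x (r + 1)) := by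
  obtain ⟨K, hK⟩ := exists_separation hm per
  have hloop : ∀ r d, ∃ M, a (r + 1 + d) = a r → ∀ i v,
      IsLoop (a r) (fun t => a (r + 1 + t)) d K i v → i ≤ M := by
    intro r d
    by_cases hrd : a (r + 1 + d) = a r
    · obtain ⟨M, hM⟩ := exists_loop_bound (a r) (fun t => a (r + 1 + t)) d K
        (fun t _ => hK _ _ (red (r + 1 + t)).symm)
        (fun t ht => hK _ _ (by rw [← hrd, ← ht]; exact (red (r + 1 + t)).symm))
      exact ⟨M, fun _ => hM⟩
    · exact ⟨0, fun h => absurd h hrd⟩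
  choose B hB using hloop
  have hbig : ∀ᶠ M in Filter.atTop, ∀ r ∈ Finset.range m, ∀ d ∈ Finset.range m, B r d ≤ M :=
    (Filter.eventually_all_finset _).2 fun r _ => (Filter.eventually_all_finset _).2 fun d _ =>
      Filter.eventually_ge_atTop _
  -- Sources above this bound have level greater than `2 ^ K + m`. As a word the level then has
  -- length at least `K`, where distinct branches are separated, and as a number it exceeds the
  -- length of every descent between consecutive sites.
  obtain ⟨M, hM, hM'⟩ := (hbig.and (Filter.eventually_ge_atTop
    (2 * Nat.pair (2 ^ K + m) (width (2 ^ K + m))))).exists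
  refine ⟨M, fun x xper walk large hstep => ?_⟩
  have hlev : ∀ {b : Branch} {r v}, DeclOn b (x r) v → 2 ^ K + m < tag (x r) := fun {b r v} h =>
    lt_tag_of_lt h.eq_pair h.index_le (hM'.trans_lt (large r))
  have hex : ∃ r, Site (a r) (x r) (x (r + 1)) := by
    by_contra! hc
    have h1 : ∀ r, x r = child (a r) (x (r + 1)) := fun r => (hstep r).resolve_right (hc r)
    have h2 : StrictAnti x := strictAnti_nat_of_succ_lt fun r => by
      have := child_lt (a r) (x (r + 1)); rw [← h1] at this; exact this
    have := h2 hm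
    rw [← xper 0, zero_add] at this
    exact this.false
  have hperS : ∀ r, Site (a (r % m)) (x (r % m)) (x (r % m + 1)) ↔ Site (a r) (x r) (x (r + 1)) :=
    fun r => by rw [← walk, ← walk, mod_eq per, mod_eq xper]
  classical
  obtain ⟨r₀, hr₀, hmax⟩ := ((Finset.range m).filter fun r => Site (a r) (x r) (x (r + 1))).exists_max_image
    (fun r => tag (x r)) (by
      obtain ⟨r, hr⟩ := hex
      exact ⟨r % m, by simp [Nat.mod_lt _ hm, hperS, hr]⟩)
  rw [Finset.mem_filter, Finset.mem_range] at hr₀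
  obtain ⟨hr₀m, hs⟩ := hr₀
  have hmax' : ∀ r, Site (a r) (x r) (x (r + 1)) → tag (x r) ≤ tag (x r₀) := fun r hr => by
    have := hmax (r % m) (by simp [Nat.mod_lt _ hm, hperS, hr])
    rwa [mod_eq xper] at this
  have hnext : ∃ d, Site (a (r₀ + 1 + d)) (x (r₀ + 1 + d)) (x (r₀ + 1 + d + 1)) := by
    refine ⟨m - 1, ?_⟩
    rw [show r₀ + 1 + (m - 1) = r₀ + m by omega, ← hperS, Nat.add_mod_right, hperS]
    exact hs
  obtain ⟨d, hd, hdmin⟩ : ∃ d, Site (a (r₀ + 1 + d)) (x (r₀ + 1 + d)) (x (r₀ + 1 + d + 1)) ∧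
      ∀ t < d, ¬ Site (a (r₀ + 1 + t)) (x (r₀ + 1 + t)) (x (r₀ + 1 + t + 1)) :=
    ⟨Nat.find hnext, Nat.find_spec hnext, fun t => Nat.find_min hnext⟩
  have hdm : d < m := by
    by_contra! hc
    refine hdmin (m - 1) (by omega) ?_
    rw [show r₀ + 1 + (m - 1) = r₀ + m by omega, ← hperS, Nat.add_mod_right, hperS]
    exact hs
  have hdown : ∀ t < d, x (r₀ + 1 + t) = child (a (r₀ + 1 + t)) (x (r₀ + 1 + (t + 1))) := fun t ht =>
    (hstep _).resolve_right (hdmin t ht)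
  obtain ⟨hgrow, hpar⟩ := descent (y := fun t => x (r₀ + 1 + t)) (α := fun t => a (r₀ + 1 + t)) hdown
  simp only [add_zero] at hgrow hpar
  have hl := hlev hs.1
  -- From a source of smaller level, `d` ascents stay below `width (tag (x r₀))`, hence below the
  -- target from which the descent starts.
  have hle : tag (x r₀) ≤ tag (x (r₀ + 1 + d)) := by
    by_contra! hc
    have h1 := grow_iterate_lt_width (d := d) hc hd.1.index_le
      (by have := Nat.two_pow_pos K; omega)
    rw [← hd.1.eq_pair] at h1
    have := hs.1.width_le
    omega
  have heq : tag (x r₀) = tag (x (r₀ + 1 + d)) := hle.antisymm (hmax' _ hd)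
  have hKl : K ≤ Nat.log 2 (tag (x r₀)) := two_pow_lt_log (by omega)
  -- Both branches pass through the common level word, which is long enough to separate distinct
  -- branches.
  have haeq : a (r₀ + 1 + d) = a r₀ := by
    by_contra hne
    refine hK _ _ hne _ hKl ?_
    rw [hs.1.level, heq, hd.1.level]
  have hsame : x r₀ = x (r₀ + 1 + d) :=
    (hs.1.eq_of_level_eq (haeq ▸ hd.1) heq).1
  have hKM : K < M := by
    have h1 := Nat.left_le_pair (2 ^ K + m) (width (2 ^ K + m))
    have h2 : K < 2 ^ K := Nat.lt_two_pow_self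
    omega
  have hlp : IsLoop (a r₀) (fun t => a (r₀ + 1 + t)) d K (x r₀) (x (r₀ + 1)) := by
    refine ⟨hs, hKl, by rw [hpar d le_rfl, hsame], fun t ht => ?_, fun t ht => ?_, fun t ht => ?_⟩
    · rw [hpar t ht.le, hpar (t + 1) ht]; exact hdown t ht
    · rw [hpar (t + 1) ht]
      rintro ⟨y, hy⟩
      have h1 := mate_of_site hy
      have h2 := walk (r₀ + 1 + t)
      rw [add_assoc (r₀ + 1) t 1] at h2
      have h3 : x (r₀ + 1 + t) = y := by rw [← h1, ← h2, mate_mate]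
      have h4 := not_isEnd_child (a (r₀ + 1 + t)) (x (r₀ + 1 + (t + 1)))
      rw [← hdown t ht, h3] at h4
      exact h4 ⟨_, hy.symm⟩
    · rw [hpar (t + 1) ht]; exact hKM.le.trans (large _).le
  have h1 := hB r₀ d haeq _ _ hlp
  have h2 := hM r₀ (Finset.mem_range.2 hr₀m) d (Finset.mem_range.2 hdm)
  have h3 := large r₀
  omega

/-- Among large vertices an ascending step is followed by an ascending one: turning back would make
neighbouring branches share a long word, either an edge label or a source level. So the walk or its
reversal descends throughout. -/
theorem exists_small_vertex {a : ℕ → Branch} {m : ℕ} (hm : 0 < m) (per : ∀ r, a (r + m) = a r)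
    (red : ∀ r, a (r + 1) ≠ a r) :
    ∃ M, ∀ x : ℕ → ℕ, (∀ r, x (r + m) = x r) → (∀ r, mate (a r) (x r) = x (r + 1)) →
      ∃ r, x r ≤ M := by
  obtain ⟨c, rfl⟩ : ∃ c, m = c + 1 := ⟨m - 1, by omega⟩
  have hmul : ∀ {α : Type} (f : ℕ → α), (∀ r, f (r + (c + 1)) = f r) → ∀ k r,
      f (r + k * (c + 1)) = f r := fun f hf k r => Function.Periodic.nat_mul hf k r
  obtain ⟨K, hK⟩ := exists_separation hm per
  obtain ⟨M₁, hM₁⟩ := no_descending_walk hm per red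
  -- As `m = c + 1`, multiplication by `c` is negation modulo `m`, so this is the reversed word. The
  -- shift `r + 1` appears because each edge is traversed from its other end.
  obtain ⟨M₂, hM₂⟩ := no_descending_walk (a := fun r => a (c * (r + 1))) hm
    (fun r => by
      rw [show c * (r + (c + 1) + 1) = c * (r + 1) + c * (c + 1) by ring]
      exact hmul a per c _)
    (fun r => by
      have := red (c * (r + 1 + 1))
      rw [show c * (r + 1 + 1) + 1 = c * (r + 1) + (c + 1) by ring, per] at this
      exact this.symm)
  refine ⟨M₁ + M₂ + 2 * Nat.pair (2 ^ K) (width (2 ^ K)), fun x xper walk => ?_⟩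
  by_contra! large
  have hKx : ∀ r, K < x r := fun r => by
    have h1 := Nat.left_le_pair (2 ^ K) (width (2 ^ K))
    have h2 : K < 2 ^ K := Nat.lt_two_pow_self
    have := large r
    omega
  have hlev : ∀ {b : Branch} {r v}, DeclOn b (x r) v → K ≤ Nat.log 2 (tag (x r)) :=
    fun {b r v} h => two_pow_lt_log
      (lt_tag_of_lt h.eq_pair h.index_le (by have := large r; omega))
  have hcase : ∀ r, (x (r + 1) = child (a r) (x r) ∨ Site (a r) (x (r + 1)) (x r)) ∨
      (x r = child (a r) (x (r + 1)) ∨ Site (a r) (x r) (x (r + 1))) := fun r => by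
    have := (gen_mate (a r)).cases (x r)
    rw [walk] at this
    tauto
  have hup : ∀ r, (x (r + 1) = child (a r) (x r) ∨ Site (a r) (x (r + 1)) (x r)) →
      (x (r + 1 + 1) = child (a (r + 1)) (x (r + 1)) ∨
        Site (a (r + 1)) (x (r + 1 + 1)) (x (r + 1))) := by
    rintro r (h | h)
    · refine (hcase (r + 1)).resolve_right ?_
      rintro (h' | h')
      · have h1 : x r = x (r + 1 + 1) := by rw [← par_child (a r) (x r), ← h, h', par_child]
        have h2 : a r (x r) = a (r + 1) (x r) := by
          rw [← tag_child (a r) (x r), ← h, h', tag_child, h1]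
        exact hK _ _ (red r) _ (hKx r).le h2.symm
      · exact h'.1.src_ne_child _ _ h
    · refine (hcase (r + 1)).resolve_right ?_
      rintro (h' | h')
      · exact h.1.src_ne_child _ _ h'
      · refine hK _ _ (red r) _ (hlev h.1) ?_
        rw [h.1.level, h'.1.level]
  by_cases hd : ∀ r, x r = child (a r) (x (r + 1)) ∨ Site (a r) (x r) (x (r + 1))
  · exact hM₁ x xper walk (fun r => by have := large r; omega) hd
  · push Not at hd
    obtain ⟨r₀, hr₀⟩ := hd
    have h0 := (hcase r₀).resolve_right (by tauto)
    have h1 : ∀ k, x (r₀ + k + 1) = child (a (r₀ + k)) (x (r₀ + k)) ∨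
        Site (a (r₀ + k)) (x (r₀ + k + 1)) (x (r₀ + k)) := by
      intro k
      induction k with
      | zero => exact h0
      | succ k ih => exact hup _ ih
    -- Adding `r₀` periods carries the ascent over to the indices before `r₀`.
    have h2 : ∀ r, x (r + 1) = child (a r) (x r) ∨ Site (a r) (x (r + 1)) (x r) := fun r => by
      have := h1 (r + r₀ * c)
      rw [show r₀ + (r + r₀ * c) + 1 = r + 1 + r₀ * (c + 1) by ring,
        show r₀ + (r + r₀ * c) = r + r₀ * (c + 1) by ring, hmul x xper, hmul x xper,
        hmul a per] at this
      exact this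
    have h3 : ∀ r, x (c * (r + 1) + 1) = x (c * r) := fun r => by
      rw [show c * (r + 1) + 1 = c * r + (c + 1) by ring, xper]
    refine hM₂ (fun r => x (c * r)) (fun r => ?_) (fun r => ?_)
      (fun r => by have := large (c * r); omega) (fun r => ?_)
    · rw [show c * (r + (c + 1)) = c * r + c * (c + 1) by ring]
      exact hmul x xper c _
    · rw [← h3, ← walk, mate_mate]
    · have := h2 (c * (r + 1))
      rwa [h3] at this

/-! ### The group is cofinitary -/

/-- The closed walk of a fixed point meets a vertex up to `M` at one of `m` positions, and position
and vertex determine the fixed point. -/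
theorem finite_fixed_of_reduced {a : ℕ → Branch} {m : ℕ} (hm : 0 < m) (per : ∀ r, a (r + m) = a r)
    (red : ∀ r, a (r + 1) ≠ a r) :
    {n | wordProd ((List.range m).map a).reverse n = n}.Finite := by
  obtain ⟨M, hM⟩ := exists_small_vertex hm per red
  let w : ℕ → Equiv.Perm ℕ := fun r => wordProd ((List.range r).map a).reverse
  have hw : ∀ r n, w (r + 1) n = mate (a r) (w r n) := fun r n => by
    simp [w, List.range_succ]
  have hsub : {n | w m n = n} ⊆ ⋃ r ∈ Finset.range m, w r ⁻¹' Set.Iic M := by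
    intro n hn
    have hper : ∀ r, w (r + m) n = w r n := by
      intro r
      induction r with
      | zero => rw [zero_add, hn]; simp [w]
      | succ r ih => rw [Nat.succ_add_eq_add_succ, Nat.succ_eq_add_one, ← add_assoc, hw, ih, per, ← hw]
    obtain ⟨r, hr⟩ := hM (fun r => w r n) hper (fun r => (hw r n).symm)
    simp only [Set.mem_iUnion]
    refine ⟨r % m, Finset.mem_range.2 (Nat.mod_lt _ hm), ?_⟩
    rw [Set.mem_preimage, mod_eq (f := fun r => w r n) hper]
    exact hr
  refine Set.Finite.subset (Set.Finite.biUnion (Finset.range m).finite_toSet fun r _ => ?_) hsub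
  exact (Set.finite_Iic M).preimage (w r).injective.injOn

theorem finite_fixed_conj (g p : Equiv.Perm ℕ) (h : {n | p n = n}.Finite) :
    {n | (g * p * g⁻¹) n = n}.Finite := by
  refine (h.preimage (f := ⇑g⁻¹) (g⁻¹).injective.injOn).subset fun n hn => ?_
  simp only [Set.mem_ofPred_eq, Set.mem_preimage, Equiv.Perm.mul_apply] at hn ⊢
  rw [Equiv.Perm.eq_inv_iff_eq, hn]

/-- Equal ends are removed by conjugation and equal neighbours cancel. What remains is empty, a
single fixed-point-free generator, or cyclically reduced. -/
theorem wordProd_eq_one_or_finite_fixed (L : List Branch) :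
    wordProd L.reverse = 1 ∨ {n | wordProd L.reverse n = n}.Finite := by
  induction hn : L.length using Nat.strong_induction_on generalizing L with
  | _ m ih =>
    subst hn
    rcases L.eq_nil_or_concat with rfl | ⟨L', b, rfl⟩
    · simp
    rcases L' with _ | ⟨c, L'⟩
    · right
      have : {n | mate b n = n} = ∅ := Set.eq_empty_of_forall_notMem (gen_mate b).ne
      simp [this]
    by_cases hbc : c = b
    · subst hbc
      have h1 : wordProd (List.concat (c :: L') c).reverse
          = gen c * wordProd L'.reverse * (gen c)⁻¹ := by
        simp [mul_assoc]
      rw [h1]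
      rcases ih L'.length (by simp) L' rfl with h | h
      · left; simp [h]
      · right; exact finite_fixed_conj _ _ h
    by_cases hadj : ∃ (u : List Branch) (d : Branch) (v : List Branch),
        (c :: L').concat b = u ++ d :: d :: v
    · obtain ⟨u, d, v, h⟩ := hadj
      rw [h]
      have h1 : wordProd (u ++ d :: d :: v).reverse = wordProd (u ++ v).reverse := by
        simp [← mul_assoc (gen d) (gen d)]
      rw [h1]
      exact ih (u ++ v).length (by rw [h]; simp) _ rfl
    · right
      set L := (c :: L').concat b with hL
      have hlen : 0 < L.length := by simp [hL]
      let a : ℕ → Branch := fun r => L[r % L.length]'(Nat.mod_lt _ hlen)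
      have ha : ∀ r (hr : r < L.length), a r = L[r] := fun r hr => by
        simp [a, Nat.mod_eq_of_lt hr]
      have hmap : (List.range L.length).map a = L := by
        refine List.ext_getElem (by simp) fun r h1 h2 => ?_
        simp [ha r h2]
      have per : ∀ r, a (r + L.length) = a r := fun r => by simp [a]
      have := finite_fixed_of_reduced hlen per fun r hr => ?_
      · rwa [hmap] at this
      · have hr' : a (r % L.length + 1) = a (r % L.length) := by
          simpa [a] using hr
        have hlt := Nat.mod_lt r hlen
        generalize r % L.length = s at hr' hlt
        by_cases hs : s + 1 < L.length
        · refine hadj ⟨L.take s, L[s], L.drop (s + 1 + 1), ?_⟩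
          rw [ha _ hs, ha _ hlt] at hr'
          conv_lhs => rw [← List.take_append_drop s L, List.drop_eq_getElem_cons hlt,
            List.drop_eq_getElem_cons hs, hr']
        · have hs' : s + 1 = L.length := by omega
          have h0 : a (s + 1) = c := by
            rw [hs', ← zero_add L.length, per, ha 0 hlen]
            simp [hL]
          have h1 : a s = b := by
            rw [ha s hlt]
            simp only [hL, List.concat_eq_append] at hs' ⊢
            rw [List.getElem_append_right (by simp at hs' ⊢; omega)]
            simp
          exact hbc (h0.symm.trans (hr'.trans h1))

theorem isCofinitary_genGroup : IsCofinitary genGroup := by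
  intro g hg hne
  obtain ⟨L, rfl⟩ := mem_genGroup.1 hg
  have := wordProd_eq_one_or_finite_fixed L.reverse
  rw [List.reverse_reverse] at this
  exact this.resolve_left hne

/-- If every permutation agrees infinitely often with an element of a cofinitary group, the group
is maximal. -/
theorem isMaximalCofinitary_of_catch {G : Subgroup (Equiv.Perm ℕ)} (hG : IsCofinitary G)
    (hc : ∀ h : Equiv.Perm ℕ, ∃ g ∈ G, {n | g n = h n}.Infinite) : IsMaximalCofinitary G := by
  refine ⟨hG, fun H hH hle h hh => ?_⟩
  obtain ⟨g, hg, hinf⟩ := hc h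
  by_contra hn
  refine hinf ((hH (g⁻¹ * h) (mul_mem (inv_mem (hle hg)) hh) fun h1 => hn ?_).subset fun n hn => ?_)
  · rw [inv_mul_eq_one] at h1
    exact h1 ▸ hg
  · simp only [Set.mem_ofPred_eq, Equiv.Perm.mul_apply] at hn ⊢
    rw [← hn]; simp

/-! ### Branches through given words -/

/-- The branch through `c` that continues with zeros. -/
def Branch.through (c : ℕ) (hc : 0 < c) : Branch where
  val n := if n ≤ Nat.log 2 c then c / 2 ^ (Nat.log 2 c - n) else c * 2 ^ (n - Nat.log 2 c)
  val_zero := by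
    have h1 := Nat.pow_log_le_self 2 hc.ne'
    have h2 := Nat.lt_pow_succ_log_self one_lt_two c
    simp only [Nat.zero_le, if_true, Nat.sub_zero]
    rw [Nat.div_eq_iff (by positivity)]
    rw [pow_succ] at h2
    omega
  val_succ n := by
    rcases Nat.lt_trichotomy n (Nat.log 2 c) with h | h | h
    · rw [if_pos (by omega), if_pos h.le, Nat.div_div_eq_div_mul, ← pow_succ]
      congr 2; omega
    · rw [if_neg (by omega), if_pos h.le, h]; simp
    · rw [if_neg (by omega), if_neg (by omega), show n + 1 - Nat.log 2 c = n - Nat.log 2 c + 1 by omega,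
        pow_succ, ← mul_assoc, Nat.mul_div_cancel _ two_pos]

theorem Branch.through_log {c : ℕ} (hc : 0 < c) : Branch.through c hc (Nat.log 2 c) = c := by
  simp [Branch.through]

theorem exists_branch_of_chain {c : ℕ → ℕ} (hpos : ∀ q, 0 < c q)
    (hp : ∀ q, IsPfx (c q) (c (q + 1))) (hlog : ∀ q, Nat.log 2 (c q) < Nat.log 2 (c (q + 1))) :
    ∃ a : Branch, ∀ q, a (Nat.log 2 (c q)) = c q := by
  have hmono : StrictMono fun q => Nat.log 2 (c q) := strictMono_nat_of_lt_succ hlog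
  let T : ℕ → Branch := fun q => Branch.through (c q) (hpos q)
  have hT : ∀ q, T q (Nat.log 2 (c q)) = c q := fun q => Branch.through_log _
  have hagree : ∀ q n, n ≤ Nat.log 2 (c q) → T (q + 1) n = T q n := fun q n hn => by
    refine Branch.eq_of_val_le hn ?_
    have := hp q
    rw [← hT (q + 1), Branch.isPfx_iff] at this
    rw [this.2, hT]
  have hagree' : ∀ q n k, n ≤ Nat.log 2 (c q) → T (q + k) n = T q n := fun q n k hn => by
    induction k with
    | zero => rfl
    | succ k ih => rw [← add_assoc, hagree _ _ (hn.trans (hmono.monotone (by omega))), ih]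
  -- The word `c n` has length at least `n`, so the value at `n` has stabilized by stage `n`.
  refine ⟨⟨fun n => T n n, (T 0).val_zero, fun n => ?_⟩, fun q => ?_⟩
  · rw [(T (n + 1)).val_succ]
    exact hagree n n hmono.le_apply
  · have h1 : q ≤ Nat.log 2 (c q) := hmono.le_apply
    obtain ⟨k, hk⟩ := Nat.exists_eq_add_of_le h1
    change T (Nat.log 2 (c q)) (Nat.log 2 (c q)) = c q
    conv_rhs => rw [← hT q]
    conv_lhs => rw [show T (Nat.log 2 (c q)) = T (q + k) by rw [← hk]]
    exact hagree' q _ k le_rfl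

/-! ### Coherent chains -/

/-- A bound for the length of the words that declare pairs with target `v`. -/
def declBound (v : ℕ) : ℕ := 2 * Nat.pair (2 * Nat.pair v v) v + 2

theorem declBound_mono : Monotone declBound := fun v w h => by
  have h1 := pair_le_pair h h
  have h2 := pair_le_pair (show 2 * Nat.pair v v ≤ 2 * Nat.pair w w by omega) h
  unfold declBound; omega

theorem lt_declBound (v : ℕ) : v < declBound v := by
  have := Nat.right_le_pair (2 * Nat.pair v v) v
  unfold declBound; omega

theorem DeclOn.le_declBound {a : Branch} {i v : ℕ} (h : DeclOn a i v) :
    2 * Nat.pair i v + 2 ≤ declBound v := by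
  have := pair_le_pair h.src_le (le_refl v)
  unfold declBound; omega

/-- Along the chain the labels at each step `t` of the descents extend one another and define a
branch `z t`. Its generator really uses the edges of step `t`, so the product along the `z t` maps
each source to its target. -/
theorem exists_word_of_coherent_chain {C : ℕ → ℕ} (hd : ∀ q, Decl (C q)) (hpos : ∀ q, 0 < src (C q))
    (hc : ∀ q, Coh (C q) (C (q + 1))) (hfast : ∀ q, declBound (tgt (C q)) ≤ src (C (q + 1))) :
    ∃ L, ∀ q, wordProd L (src (C q)) = tgt (C q) := by
  have hc' : ∀ q, _ := fun q => by have := hc q; rw [Coh] at this; exact this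
  choose m _ hm hm' hstep using hc'
  -- Vertices before the end of a descent are odd and sources are even, so neither descent can stop
  -- earlier.
  have hmeq : ∀ q, m (q + 1) = m q := fun q => by
    rcases Nat.lt_trichotomy (m (q + 1)) (m q) with h | h | h
    · have h1 := (hstep q _ h).1.2.1
      rw [hm] at h1
      have := (hd (q + 1)).src_even
      omega
    · exact h
    · have h1 := (hstep (q + 1) _ h).1.1
      rw [hm'] at h1
      have := (hd (q + 1)).src_even
      omega
  obtain ⟨M, hM⟩ : ∃ M, ∀ q, m q = M := ⟨m 0, fun q => by
    induction q with
    | zero => rfl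
    | succ q ih => rw [hmeq, ih]⟩
  simp only [hM] at hm hm' hstep
  have hlow : ∀ q, ∀ t ≤ M, src (C q) ≤ par^[t] (tgt (C q)) := fun q t ht => by
    rw [← hm q]; exact par_iterate_le_of_le ht _
  have hbranch : ∀ t, ∃ z : Branch, t < M → ∀ q,
      z (par^[t + 1] (tgt (C q))) = tag (par^[t] (tgt (C q))) := by
    intro t
    by_cases ht : t < M
    · have hlog : ∀ q, Nat.log 2 (tag (par^[t] (tgt (C q)))) = par^[t + 1] (tgt (C q)) := fun q => by
        rw [Function.iterate_succ_apply']; exact (hstep q t ht).1.2.2.1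
      obtain ⟨z, hz⟩ := exists_branch_of_chain (c := fun q => tag (par^[t] (tgt (C q))))
        (fun q => by
          rcases Nat.eq_zero_or_pos (tag (par^[t] (tgt (C q)))) with h | h
          · have h1 := hlog q
            have h2 := hlow q (t + 1) ht
            have h3 := hpos q
            rw [h, Nat.log_zero_right] at h1
            omega
          · exact h)
        (fun q => (hstep q t ht).1.2.2.2.1)
        (fun q => by
          rw [hlog, hlog]
          exact ((par_iterate_le _ _).trans_lt (lt_declBound _)).trans_le
            ((hfast q).trans (hlow (q + 1) (t + 1) ht)))
      refine ⟨z, fun _ q => ?_⟩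
      rw [← hlog]; exact hz q
    · exact ⟨Branch.through 1 one_pos, fun h => absurd h ht⟩
  choose z hz using hbranch
  have hmate : ∀ t < M, ∀ q, mate (z t) (par^[t + 1] (tgt (C q))) = par^[t] (tgt (C q)) := by
    intro t ht q
    obtain ⟨⟨hodd, -, -, -, hred⟩, hlive⟩ := hstep q t ht
    rw [← Function.iterate_succ_apply' par t, ← hz t ht q] at hred
    have hchild : par^[t] (tgt (C q)) = child (z t) (par^[t + 1] (tgt (C q))) := by
      rw [child, hz t ht, Function.iterate_succ_apply']
      exact eq_of_odd hodd
    -- If the vertex were a source, or matched with its own predecessor, its tag would be an initial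
    -- segment of the edge label, against reducedness. If it were the target of a site, `hfast`
    -- makes the declaring word visible in the next label, and coherence there provides a later
    -- coherent pair.
    rcases (gen_mate (z t)).cases (par^[t + 1] (tgt (C q))) with h | h | h | h
    · refine absurd ?_ hred
      rw [Nat.succ_eq_add_one, ← h.1.level]
      exact Branch.isPfx_val _ ((Nat.log_le_self _ _).trans (tag_le _))
    · exfalso
      set n := par^[t + 1] (tgt (C q)) with hn
      set g := mate (z t) n
      have hle : 2 * Nat.pair g n + 2 ≤ par^[t + 1] (tgt (C (q + 1))) :=
        (h.1.le_declBound.trans (declBound_mono (par_iterate_le _ _))).trans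
          ((hfast q).trans (hlow (q + 1) (t + 1) ht))
      have hp : IsPfx (z t (2 * Nat.pair g n + 2)) (tag (par^[t] (tgt (C (q + 1))))) := by
        rw [← hz t ht]; exact Branch.isPfx_val _ hle
      have hlt : z t (2 * Nat.pair g n + 2) < C (q + 1) := by
        refine ((hp.le.trans (tag_le _)).trans (par_iterate_le _ _)).trans_lt (tgt_lt fun h0 => ?_)
        have := (hd (q + 1)).marked.1
        omega
      obtain ⟨S, -, h1, h2, h3, h4⟩ := hlive _ hlt hp h.1
        (by rw [tgt_branch, hn, Function.iterate_succ_apply'])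
      rw [← hz t ht, Branch.isPfx_iff] at h1
      rw [← h1.2] at h2 h3 h4
      exact h.2 _ ((z t).strictMono.lt_iff_lt.1 h2) h3 h4
    · rw [h, hchild]
    · refine absurd ?_ hred
      set g := mate (z t) (par^[t + 1] (tgt (C q)))
      have hlt := child_lt (z t) g
      rw [← h] at hlt
      have : tag (par^[t + 1] (tgt (C q))) = z t g := by
        conv_lhs => rw [h]
        exact tag_child _ _
      rw [Nat.succ_eq_add_one, this]
      exact Branch.isPfx_val _ hlt.le
  refine ⟨(List.range M).map z, fun q => ?_⟩
  have : ∀ k ≤ M, wordProd ((List.range k).map z) (par^[k] (tgt (C q))) = tgt (C q) := by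
    intro k
    induction k with
    | zero => simp
    | succ k ih =>
      intro hk
      rw [List.range_succ, List.map_append, wordProd_append, Equiv.Perm.mul_apply]
      simp only [List.map_cons, List.map_nil, wordProd_cons, wordProd_nil, mul_one, gen_apply]
      rw [hmate k hk, ih (by omega)]
  have h1 := this M le_rfl
  rwa [hm] at h1

/-! ### Catching a permutation -/

/-- Pigeonhole: there is one index more than there are values below `width s`. -/
theorem exists_index (h : Equiv.Perm ℕ) (s : ℕ) :
    ∃ j ≤ width s, width s ≤ h (2 * Nat.pair s j) := by
  by_contra! hc
  obtain ⟨i, hi, j, hj, hne, heq⟩ := Finset.exists_ne_map_eq_of_card_lt_of_maps_to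
    (s := Finset.range (width s + 1)) (t := Finset.range (width s))
    (f := fun j => h (2 * Nat.pair s j)) (by simp)
    (fun j hj => by
      simp only [Finset.coe_range, Set.mem_Iio] at hj ⊢
      exact hc j (by omega))
  have := h.injective heq
  have : Nat.pair s i = Nat.pair s j := by omega
  exact hne (by simpa using this)

theorem IsPfx.exists_div {s c : ℕ} (h : IsPfx s c) : ∃ q, s = c / 2 ^ q ∧ q = Nat.log 2 c - Nat.log 2 s :=
  ⟨_, h.symm, rfl⟩

/-- The word `s` followed by the digit `e`, zeros, and a final one. -/
def extendWord (s e r : ℕ) : ℕ := s * 2 ^ (r + 1) + e * 2 ^ r + 1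

section extendWord

variable {s e r : ℕ}

theorem log_extendWord (hs : 0 < s) (he : e ≤ 1) (hr : 0 < r) :
    Nat.log 2 (extendWord s e r) = Nat.log 2 s + r + 1 := by
  have h1 := Nat.pow_log_le_self 2 hs.ne'
  have h2 := Nat.lt_pow_succ_log_self one_lt_two s
  have h3 : 2 ≤ 2 ^ r := by
    calc 2 = 2 ^ 1 := rfl
      _ ≤ 2 ^ r := Nat.pow_le_pow_right two_pos hr
  have h4 : e * 2 ^ r ≤ 2 ^ r := by nlinarith
  apply Nat.log_eq_of_pow_le_of_lt_pow
  · have : 2 ^ Nat.log 2 s * 2 ^ (r + 1) ≤ s * 2 ^ (r + 1) := Nat.mul_le_mul_right _ h1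
    rw [add_assoc, pow_add]
    unfold extendWord
    omega
  · have : (s + 1) * 2 ^ (r + 1) ≤ 2 ^ (Nat.log 2 s).succ * 2 ^ (r + 1) := Nat.mul_le_mul_right _ h2
    rw [show Nat.log 2 s + r + 1 + 1 = (Nat.log 2 s).succ + (r + 1) by simp only [Nat.succ_eq_add_one]; omega,
      pow_add 2 (Nat.log 2 s).succ]
    unfold extendWord
    have h5 : 2 ^ (r + 1) = 2 * 2 ^ r := pow_succ' 2 r
    rw [add_mul, one_mul] at this
    omega

theorem extendWord_div (q : ℕ) (hq : q < r) :
    extendWord s e r / 2 ^ (q + 1) = s * 2 ^ (r - q) + e * 2 ^ (r - q - 1) := by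
  obtain ⟨k, rfl⟩ : ∃ k, r = q + 1 + k := ⟨r - q - 1, by omega⟩
  rw [show q + 1 + k - q = k + 1 by omega, Nat.add_sub_cancel]
  have h1 : extendWord s e (q + 1 + k) = 1 + 2 ^ (q + 1) * (s * 2 ^ (k + 1) + e * 2 ^ k) := by
    unfold extendWord; ring
  have h2 : 1 < 2 ^ (q + 1) := Nat.one_lt_two_pow (by omega)
  rw [h1, Nat.add_mul_div_left _ _ (by positivity), Nat.div_eq_of_lt h2, zero_add]

theorem extendWord_div_even (q : ℕ) (hq : q + 1 < r) : extendWord s e r / 2 ^ (q + 1) % 2 = 0 := by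
  rw [extendWord_div q (by omega)]
  obtain ⟨k, hk⟩ : ∃ k, r - q - 1 = k + 1 := ⟨r - q - 2, by omega⟩
  have : s * 2 ^ (r - q) + e * 2 ^ (r - q - 1) = 2 * (s * 2 ^ (k + 1) + e * 2 ^ k) := by
    rw [hk, show r - q = k + 2 by omega]; ring
  omega

theorem isPfx_extendWord (hs : 0 < s) (he : e ≤ 1) (hr : 0 < r) : IsPfx s (extendWord s e r) := by
  unfold IsPfx
  rw [log_extendWord hs he hr, show Nat.log 2 s + r + 1 - Nat.log 2 s = r - 1 + 1 + 1 by omega,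
    pow_succ, ← Nat.div_div_eq_div_mul, extendWord_div _ (by omega)]
  rw [show r - (r - 1) = 1 by omega]
  simp
  omega

theorem isPfx_extendWord_digit (hs : 0 < s) (he : e ≤ 1) (hr : 0 < r) {R : ℕ}
    (hR : IsPfx R (extendWord s e r)) (hl : Nat.log 2 R = Nat.log 2 s + 1) : R = 2 * s + e := by
  rw [← hR, log_extendWord hs he hr, hl,
    show Nat.log 2 s + r + 1 - (Nat.log 2 s + 1) = r - 1 + 1 by omega, extendWord_div _ (by omega),
    show r - (r - 1) = 1 by omega]
  simp
  ring

end extendWord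

theorem IsPfx.cut {c d : ℕ} (hd : 0 < d) (h : IsPfx c d) {k : ℕ} (hk : k ≤ Nat.log 2 c) :
    ∃ c', IsPfx c' d ∧ Nat.log 2 c' = k ∧ IsPfx c' c := by
  let a := Branch.through d hd
  have ha : a (Nat.log 2 d) = d := Branch.through_log hd
  rw [← ha, Branch.isPfx_iff] at h
  refine ⟨a k, ?_, by simp, ?_⟩
  · rw [← ha]; exact a.isPfx_val (hk.trans h.1)
  · rw [← h.2]; exact a.isPfx_val hk

theorem exists_decl (h : Equiv.Perm ℕ) {s : ℕ} (hs : 0 < s) (heven : Even (Nat.log 2 s))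
    (hfix : ∀ n ≥ s, h n ≠ n) :
    ∃ P, Decl P ∧ IsPfx s P ∧ s < Nat.log 2 P ∧ tag (src P) = s ∧ tgt P = h (src P) := by
  obtain ⟨j, hj, hw⟩ := exists_index h s
  set i := 2 * Nat.pair s j with hi
  set v := h i with hv
  have hsi : s ≤ i := by have := Nat.left_le_pair s j; omega
  have hiv : i ≤ Nat.pair i v := Nat.left_le_pair i v
  have hls : Nat.log 2 s < s := Nat.log_lt_self 2 hs.ne'
  obtain ⟨r, hr⟩ : ∃ r, Nat.log 2 s + r = 2 * Nat.pair i v + 1 :=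
    ⟨2 * Nat.pair i v + 1 - Nat.log 2 s, by omega⟩
  have hr0 : 0 < r := by omega
  have hlog : ∀ e ≤ 1, Nat.log 2 (extendWord s e r) = 2 * Nat.pair i v + 2 := fun e he => by
    rw [log_extendWord hs he hr0]; omega
  have hpr : ∀ e ≤ 1, pr (extendWord s e r) = Nat.pair i v := fun e he => by
    rw [pr, hlog e he]; omega
  have hsrc : ∀ e ≤ 1, src (extendWord s e r) = i := fun e he => by
    rw [src, hpr e he, Nat.unpair_pair]
  have htgt : ∀ e ≤ 1, tgt (extendWord s e r) = v := fun e he => by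
    rw [tgt, hpr e he, Nat.unpair_pair]
  have hodd : ∀ e, extendWord s e r % 2 = 1 := fun e => by
    obtain ⟨k, rfl⟩ : ∃ k, r = k + 1 := ⟨r - 1, by omega⟩
    have : extendWord s e (k + 1) = 2 * (s * 2 ^ (k + 1) + e * 2 ^ k) + 1 := by
      unfold extendWord; ring
    omega
  -- If `v` were a child for both digits, its label would be an initial segment of `s`, and `v`
  -- would lie below `width s`.
  have hnc : ∃ e ≤ 1, ¬ IsChildOf v (extendWord s e r) := by
    by_contra! hc
    obtain ⟨h1, h2, h3⟩ := hc 0 zero_le_one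
    obtain ⟨-, -, h3'⟩ := hc 1 le_rfl
    have hpos : ∀ e, 0 < extendWord s e r := fun e => by unfold extendWord; omega
    have hle : Nat.log 2 (tag v) ≤ Nat.log 2 s := by
      by_contra! hlt
      obtain ⟨c, hc1, hc2, hc3⟩ := h3.cut (hpos 0) hlt
      obtain ⟨c', hc1', hc2', hc3'⟩ := h3'.cut (hpos 1) hlt
      have e1 := isPfx_extendWord_digit hs zero_le_one hr0 hc1 hc2
      have e2 := isPfx_extendWord_digit hs le_rfl hr0 hc1' hc2'
      unfold IsPfx at hc3 hc3'
      rw [hc2] at hc3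
      rw [hc2'] at hc3'
      omega
    have h4 : tag v < 2 ^ (par v + 1) := by
      rw [← h2]; exact Nat.lt_pow_succ_log_self one_lt_two _
    have h5 : v ≤ grow (par v) := by
      have := pair_le_pair (le_refl (par v)) h4.le
      have := eq_of_odd h1
      unfold grow
      omega
    have h6 : grow (par v) < width s := by
      obtain ⟨l, rfl⟩ : ∃ l, s = l + 1 := ⟨s - 1, by omega⟩
      have h7 : par v ≤ 2 * Nat.pair l 0 := by
        have := Nat.left_le_pair l 0
        omega
      have := grow_iterate_lt_width (l := l + 1) (l' := l) (j := 0) (d := 1) (by omega)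
        (Nat.zero_le _) (by omega)
      exact (grow_mono h7).trans_lt this
    omega
  obtain ⟨e, he, hne⟩ := hnc
  have htag : tag i = s := tag_even s j
  have hpfx := isPfx_extendWord hs he hr0
  refine ⟨extendWord s e r, ⟨⟨hodd e, by rw [hlog e he, hpr e he]⟩, ?_, ?_, ?_, ?_, ?_, ?_, ?_⟩, hpfx,
    by rw [hlog e he]; omega, by rw [hsrc e he, htag], by rw [hsrc e he, htgt e he]⟩
  · rw [hsrc e he]; omega
  · rw [hsrc e he, htag]; exact hpfx
  · rw [hsrc e he, htag, hi]
    simpa using hj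
  · rw [hsrc e he, htag, htgt e he]; exact hw
  · rw [hsrc e he, htgt e he]; exact (hfix i hsi).symm
  · rwa [htgt e he]
  · intro R hRlt hR hm
    rw [hsrc e he, htag]
    by_contra! hlt
    obtain ⟨q, hq, hq'⟩ := hR.exists_div
    rw [log_extendWord hs he hr0] at hq'
    have hq0 : q ≠ 0 := by
      rintro rfl
      simp at hq
      omega
    obtain ⟨q, rfl⟩ := Nat.exists_eq_succ_of_ne_zero hq0
    -- A digit between `e` and the final one is zero, hence no mark. The digit `e` itself stands at
    -- an odd length because `Nat.log 2 s` is even, while marks stand at even lengths.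
    rcases Nat.lt_or_ge (q + 1) r with h1 | h1
    · have := extendWord_div_even (s := s) (e := e) q h1
      rw [← Nat.succ_eq_add_one, ← hq] at this
      have := hm.1
      omega
    · have h2 := hm.2
      obtain ⟨k, hk⟩ := heven
      omega

theorem log_mul_two_pow {D : ℕ} (hD : 0 < D) (f : ℕ) : Nat.log 2 (D * 2 ^ f) = Nat.log 2 D + f := by
  induction f with
  | zero => simp
  | succ f ih => rw [pow_succ, ← mul_assoc, Nat.log_mul_base one_lt_two (by positivity), ih]; rfl

theorem even_of_isPfx_mul_two_pow {D f R : ℕ} (hD : 0 < D) (hR : IsPfx R (D * 2 ^ f))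
    (hl : Nat.log 2 D < Nat.log 2 R) : R % 2 = 0 := by
  have hlog := log_mul_two_pow hD f
  by_cases h0 : Nat.log 2 D + f < Nat.log 2 R
  · have := Nat.log_mono_right (b := 2) hR.le
    omega
  obtain ⟨k, hk⟩ : ∃ k, f = Nat.log 2 D + f - Nat.log 2 R + (k + 1) :=
    ⟨Nat.log 2 R - Nat.log 2 D - 1, by omega⟩
  unfold IsPfx at hR
  rw [hlog] at hR
  generalize Nat.log 2 D + f - Nat.log 2 R = q at hR hk
  subst hk
  rw [pow_add, mul_left_comm, Nat.mul_div_cancel_left _ (by positivity)] at hR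
  rw [← hR, pow_succ, ← mul_assoc]
  simp

theorem isPfx_mul_two_pow {D : ℕ} (hD : 0 < D) (f : ℕ) : IsPfx D (D * 2 ^ f) := by
  rw [IsPfx, log_mul_two_pow hD, Nat.add_sub_cancel_left, Nat.mul_div_cancel _ (by positivity)]

theorem exists_agreement (h : Equiv.Perm ℕ) : ∃ g ∈ genGroup, {n | g n = h n}.Infinite := by
  by_cases hfin : {n | h n = n}.Finite
  swap
  · exact ⟨1, one_mem _, by simpa [eq_comm] using hfin⟩
  obtain ⟨n₀, hn₀⟩ : ∃ n₀, ∀ n ≥ n₀, h n ≠ n := by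
    obtain ⟨N, hN⟩ := hfin.bddAbove
    exact ⟨N + 1, fun n hn he => by have := hN he; omega⟩
  choose! D hD using fun (s : ℕ) (hs : 0 < s ∧ Even (Nat.log 2 s) ∧ n₀ ≤ s) =>
    exists_decl h hs.1 hs.2.1 fun n hn => hn₀ n (hs.2.2.trans hn)
  have hmeven : ∀ {P}, Marked P → Even (Nat.log 2 P) := fun {P} hP => by
    rw [hP.2]; exact ⟨pr P + 1, by ring⟩
  have hmpos : ∀ {P}, Marked P → 0 < P := fun {P} hP => by
    have := hP.1; omega
  -- The padding makes the next level, and with it the next source, at least `declBound` of the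
  -- current target. An even number of zeros keeps the length even.
  let s : ℕ → ℕ := fun t => Nat.rec (2 ^ (2 * n₀))
    (fun _ s => D s * 2 ^ (2 * declBound (tgt (D s)))) t
  have hs0 : s 0 = 2 ^ (2 * n₀) := rfl
  have hsS : ∀ t, s (t + 1) = D (s t) * 2 ^ (2 * declBound (tgt (D (s t)))) := fun t => rfl
  have hinv : ∀ t, 0 < s t ∧ Even (Nat.log 2 (s t)) ∧ n₀ ≤ s t := by
    intro t
    induction t with
    | zero =>
      refine ⟨by rw [hs0]; positivity, ?_, ?_⟩
      · rw [hs0, Nat.log_pow one_lt_two]; exact even_two_mul _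
      · rw [hs0]
        have : 2 * n₀ < 2 ^ (2 * n₀) := Nat.lt_two_pow_self
        omega
    | succ t ih =>
      obtain ⟨h1, h2, -⟩ := hD (s t) ih
      have hpos := hmpos h1.marked
      have hle : D (s t) ≤ s (t + 1) := by
        rw [hsS]; exact Nat.le_mul_of_pos_right _ (by positivity)
      refine ⟨hpos.trans_le hle, ?_, (ih.2.2.trans h2.le).trans hle⟩
      rw [hsS, log_mul_two_pow hpos]
      exact (hmeven h1.marked).add (even_two_mul _)
  have hP : ∀ t, Decl (D (s t)) ∧ IsPfx (s t) (D (s t)) ∧ s t < Nat.log 2 (D (s t)) ∧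
      tag (src (D (s t))) = s t ∧ tgt (D (s t)) = h (src (D (s t))) := fun t => hD _ (hinv t)
  have hPpos : ∀ t, 0 < D (s t) := fun t => hmpos (hP t).1.marked
  have hlogS : ∀ t, Nat.log 2 (s (t + 1)) = Nat.log 2 (D (s t)) + 2 * declBound (tgt (D (s t))) :=
    fun t => by rw [hsS, log_mul_two_pow (hPpos t)]
  have hlog1 : ∀ t, Nat.log 2 (s t) < Nat.log 2 (D (s t)) := fun t =>
    (Nat.log_lt_self 2 (hinv t).1.ne').trans (hP t).2.2.1
  have hpfxD : ∀ t, IsPfx (D (s t)) (s (t + 1)) := fun t => by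
    rw [hsS]; exact isPfx_mul_two_pow (hPpos t) _
  have hpfxS : ∀ t, IsPfx (s t) (s (t + 1)) := fun t => by
    have h1 := hpfxD t
    have h2 := (hP t).2.1
    have h3 := Branch.through_log (hinv (t + 1)).1
    rw [← h3, Branch.isPfx_iff] at h1 ⊢
    rw [← h1.2, Branch.isPfx_iff] at h2
    exact ⟨h2.1.trans h1.1, h2.2⟩
  obtain ⟨a, ha⟩ := exists_branch_of_chain (fun t => (hinv t).1) hpfxS
    (fun t => (hlog1 t).trans_le (by rw [hlogS]; omega))
  have haP : ∀ t, a (Nat.log 2 (D (s t))) = D (s t) := fun t => by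
    have := hpfxD t
    rw [← ha (t + 1), Branch.isPfx_iff] at this
    exact this.2
  have hsmono : StrictMono s := strictMono_nat_of_lt_succ fun t =>
    (((hP t).2.2.1).trans (Nat.log_lt_self 2 (hPpos t).ne')).trans_le (hpfxD t).le
  have hPmono : ∀ t t', t < t' → D (s t) ≤ s t' := fun t t' ht =>
    (hpfxD t).le.trans (hsmono.monotone ht)
  -- Padding zeros carry no marks, and `early` excludes marks between `s T` and the end of `D (s
  -- T)`. So `a` declares only the intended pairs.
  have hmarked : ∀ T n, n ≤ Nat.log 2 (s T) → Marked (a n) → ∃ t, a n = D (s t) := by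
    intro T
    induction T with
    | zero =>
      intro n hn hm
      exfalso
      have h1 := a.isPfx_val hn
      rw [ha 0, hs0, ← one_mul (2 ^ (2 * n₀))] at h1
      have h2 := hm.2
      rw [Branch.log_val] at h2
      have := even_of_isPfx_mul_two_pow one_pos h1 (by simp; omega)
      have := hm.1
      omega
    | succ T ih =>
      intro n hn hm
      rcases Nat.lt_trichotomy n (Nat.log 2 (D (s T))) with h1 | h1 | h1
      · refine ih n ?_ hm
        have h2 := (hP T).1.early (a n) (by rw [← haP T]; exact a.strictMono h1)
          (by rw [← haP T]; exact a.isPfx_val h1.le) hm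
        rwa [(hP T).2.2.2.1, Branch.log_val] at h2
      · exact ⟨T, by rw [h1, haP]⟩
      · exfalso
        have h2 := a.isPfx_val hn
        rw [ha (T + 1), hsS] at h2
        have := even_of_isPfx_mul_two_pow (hPpos T) h2 (by simpa using h1)
        have := hm.1
        omega
  have hdeclOn : ∀ t, a (2 * Nat.pair (src (D (s t))) (tgt (D (s t))) + 2) = D (s t) := fun t => by
    have := (hP t).1.marked.branch_eq
    rw [← this, haP]
  have hsrc : ∀ t, s t ≤ src (D (s t)) := fun t => by
    conv_lhs => rw [← (hP t).2.2.2.1]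
    exact tag_le _
  have hdecl : ∀ n, Decl (a n) → ∃ t, a n = D (s t) := fun n hn => by
    refine hmarked n n ?_ hn.marked
    have : StrictMono fun t => Nat.log 2 (s t) := strictMono_nat_of_lt_succ fun t =>
      (hlog1 t).trans_le (by rw [hlogS]; omega)
    exact this.le_apply
  by_cases hsite : ∀ N, ∃ t ≥ N, Site a (src (D (s t))) (tgt (D (s t)))
  · refine ⟨gen a, mem_genGroup.2 ⟨[a], by simp⟩, Set.infinite_of_forall_exists_gt fun N => ?_⟩
    obtain ⟨t, ht, hst⟩ := hsite (N + 1)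
    refine ⟨src (D (s t)), ?_, ?_⟩
    · simp only [Set.mem_ofPred_eq, gen_apply]
      rw [(gen_mate a).site _ _ hst, (hP t).2.2.2.2]
    · have := hsmono.le_apply (x := t)
      have := hsrc t
      omega
  -- From `N` on no declared pair is a site, so each has a later coherent one; iterating gives the
  -- chain.
  · push Not at hsite
    obtain ⟨N, hN⟩ := hsite
    have hnext : ∀ t ≥ N, ∃ t', t < t' ∧ Coh (D (s t)) (D (s t')) := by
      intro t ht
      have h1 := hN t ht
      rw [Site, DeclOn, hdeclOn] at h1
      have h2 : ∃ n > 2 * Nat.pair (src (D (s t))) (tgt (D (s t))) + 2, Decl (a n) ∧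
          Coh (D (s t)) (a n) := by
        by_contra! hc
        exact h1 ⟨(hP t).1, hc⟩
      obtain ⟨n, hn, hdn, hcoh⟩ := h2
      obtain ⟨t', ht'⟩ := hdecl n hdn
      refine ⟨t', ?_, ht' ▸ hcoh⟩
      by_contra! hle
      have h3 : D (s t') ≤ D (s t) := by
        rcases hle.eq_or_lt with rfl | hlt
        · exact le_rfl
        · exact (hPmono _ _ hlt).trans (hP t).2.1.le
      rw [← ht', ← hdeclOn t] at h3
      have := a.strictMono.le_iff_le.1 h3
      omega
    choose! nx hnx using hnext
    let τ : ℕ → ℕ := fun q => nx^[q] N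
    have hτN : ∀ q, N ≤ τ q := fun q => by
      induction q with
      | zero => exact le_rfl
      | succ q ih =>
        have := (hnx _ ih).1
        simp only [τ, Function.iterate_succ_apply'] at this ⊢
        simp only [τ] at ih
        omega
    have hτS : ∀ q, τ q < τ (q + 1) ∧ Coh (D (s (τ q))) (D (s (τ (q + 1)))) := fun q => by
      have := hnx _ (hτN q)
      simp only [τ, Function.iterate_succ_apply'] at this ⊢
      exact this
    obtain ⟨L, hL⟩ := exists_word_of_coherent_chain (C := fun q => D (s (τ q))) (fun q => (hP _).1)
      (fun q => (hinv _).1.trans_le (hsrc _)) (fun q => (hτS q).2) (fun q => by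
        refine le_trans ?_ (hsrc (τ (q + 1)))
        refine le_trans ?_ (hsmono.monotone (Nat.succ_le_of_lt (hτS q).1))
        rw [Nat.succ_eq_add_one, hsS]
        generalize declBound (tgt (D (s (τ q)))) = f
        have h1 : f < 2 ^ f := Nat.lt_two_pow_self
        have h2 : 2 ^ f ≤ 2 ^ (2 * f) := Nat.pow_le_pow_right two_pos (by omega)
        have h3 := Nat.le_mul_of_pos_left (2 ^ (2 * f)) (hPpos (τ q))
        omega)
    refine ⟨wordProd L, mem_genGroup.2 ⟨L, rfl⟩, Set.infinite_of_forall_exists_gt fun K => ?_⟩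
    have hτ : StrictMono τ := strictMono_nat_of_lt_succ fun q => (hτS q).1
    refine ⟨src (D (s (τ (K + 1)))), ?_, ?_⟩
    · simp only [Set.mem_ofPred_eq]
      rw [hL, (hP _).2.2.2.2]
    · have h1 := hτ.le_apply (x := K + 1)
      have h2 := hsmono.le_apply (x := τ (K + 1))
      have h3 := hsrc (τ (K + 1))
      omega

theorem isMaximalCofinitary_genGroup : IsMaximalCofinitary genGroup :=
  isMaximalCofinitary_of_catch isCofinitary_genGroup exists_agreement

/-! ### Primitive recursiveness -/

section Primrec

open Primrec

variable {α : Type*} [Primcodable α]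

theorem PrimrecPred.imp {p q : α → Prop} (hp : PrimrecPred p) (hq : PrimrecPred q) :
    PrimrecPred fun a => p a → q a :=
  (hp.not.or hq).of_eq fun _ => imp_iff_not_or.symm

theorem PrimrecPred.ball {f : α → ℕ} {R : α → ℕ → Prop} (hf : Primrec f)
    (hR : PrimrecPred fun p : α × ℕ => R p.1 p.2) : PrimrecPred fun a => ∀ x < f a, R a x := by
  have h : PrimrecRel fun (x : ℕ) (a : α) => R a x := hR.comp (snd.pair fst)
  exact (h.forall_mem_list.comp (list_range.comp hf) Primrec.id).of_eq (by simp)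

theorem PrimrecPred.bex {f : α → ℕ} {R : α → ℕ → Prop} (hf : Primrec f)
    (hR : PrimrecPred fun p : α × ℕ => R p.1 p.2) : PrimrecPred fun a => ∃ x < f a, R a x := by
  have h : PrimrecRel fun (x : ℕ) (a : α) => R a x := hR.comp (snd.pair fst)
  exact (h.exists_mem_list.comp (list_range.comp hf) Primrec.id).of_eq (by simp)

theorem primrec_pow : Primrec₂ ((· ^ ·) : ℕ → ℕ → ℕ) := Primrec₂.unpaired'.1 Nat.Primrec.pow

theorem primrec_log : Primrec (Nat.log 2) := by
  have h : PrimrecRel fun (c k : ℕ) => 2 ^ k ≤ c :=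
    nat_le.comp (primrec_pow.comp (const 2) snd) fst
  refine (nat_findGreatest (p := fun c k => 2 ^ k ≤ c) Primrec.id h).of_eq fun c => ?_
  rcases Nat.eq_zero_or_pos c with rfl | hc
  · simp
  · rw [Nat.findGreatest_eq_iff]
    refine ⟨Nat.log_le_self 2 c, fun _ => Nat.pow_log_le_self 2 hc.ne', fun k hk _ => ?_⟩
    exact not_le.2 (Nat.lt_pow_of_log_lt one_lt_two hk)

theorem primrec_isPfx : PrimrecRel IsPfx :=
  Primrec.eq.comp (nat_div.comp snd (primrec_pow.comp (const 2)
    (nat_sub.comp (primrec_log.comp snd) (primrec_log.comp fst)))) fst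

theorem primrec_half : Primrec fun y : ℕ => y / 2 := nat_div.comp .id (const 2)

theorem primrec_odd : PrimrecPred fun y : ℕ => y % 2 = 1 :=
  Primrec.eq.comp (nat_mod.comp .id (const 2)) (const 1)

theorem primrec_even : PrimrecPred fun y : ℕ => y % 2 = 0 :=
  Primrec.eq.comp (nat_mod.comp .id (const 2)) (const 0)

theorem primrec_par : Primrec par := fst.comp (unpair.comp primrec_half)

theorem primrec_index : Primrec fun y : ℕ => (Nat.unpair (y / 2)).2 :=
  snd.comp (unpair.comp primrec_half)

theorem primrec_tag : Primrec tag := Primrec.ite primrec_odd primrec_index primrec_par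

theorem primrec_grow : Primrec grow :=
  succ.comp (nat_mul.comp (const 2) (Primrec₂.natPair.comp .id (primrec_pow.comp (const 2) succ)))

theorem primrec_width : Primrec width := by
  have : Primrec₂ fun l w => grow^[l + 1] (2 * Nat.pair l w) + 1 :=
    succ.comp (nat_iterate (succ.comp fst) (nat_mul.comp (const 2) (Primrec₂.natPair.comp fst snd))
      (primrec_grow.comp snd).to₂)
  exact (nat_rec₁ 0 this).of_eq fun n => by
    induction n with
    | zero => rfl
    | succ n ih => simp only [width, ← ih]

theorem primrec_pr : Primrec pr := primrec_half.comp (nat_sub.comp primrec_log (const 2))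

theorem primrec_src : Primrec src := fst.comp (unpair.comp primrec_pr)

theorem primrec_tgt : Primrec tgt := snd.comp (unpair.comp primrec_pr)

theorem primrec_isChildOf : PrimrecRel IsChildOf :=
  (primrec_odd.comp fst).and ((Primrec.eq.comp (primrec_log.comp (primrec_tag.comp fst))
    (primrec_par.comp fst)).and (primrec_isPfx.comp (primrec_tag.comp fst) snd))

theorem primrec_marked : PrimrecPred Marked :=
  primrec_odd.and (Primrec.eq.comp primrec_log
    (nat_add.comp (nat_mul.comp (const 2) primrec_pr) (const 2)))

theorem primrec_decl : PrimrecPred Decl := by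
  have hl : Primrec fun P => tag (src P) := primrec_tag.comp primrec_src
  have hearly : PrimrecPred fun P => ∀ R < P, IsPfx R P → Marked R →
      Nat.log 2 R ≤ Nat.log 2 (tag (src P)) :=
    PrimrecPred.ball .id ((primrec_isPfx.comp snd fst).imp ((primrec_marked.comp snd).imp
      (nat_le.comp (primrec_log.comp snd) (primrec_log.comp (hl.comp fst)))))
  refine (primrec_marked.and ((primrec_even.comp primrec_src).and
    ((primrec_isPfx.comp hl .id).and ((nat_le.comp (primrec_index.comp primrec_src)
    (primrec_width.comp hl)).and ((nat_le.comp (primrec_width.comp hl) primrec_tgt).and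
    ((Primrec.eq.comp primrec_src primrec_tgt).not.and
    ((primrec_isChildOf.comp primrec_tgt .id).not.and hearly))))))).of_eq fun P => ?_
  exact ⟨fun ⟨h1, h2, h3, h4, h5, h6, h7, h8⟩ => ⟨h1, h2, h3, h4, h5, h6, h7, h8⟩,
    fun ⟨h1, h2, h3, h4, h5, h6, h7, h8⟩ => ⟨h1, h2, h3, h4, h5, h6, h7, h8⟩⟩

theorem primrec_descentStep : PrimrecRel DescentStep :=
  (primrec_odd.comp fst).and ((primrec_odd.comp snd).and
    ((Primrec.eq.comp (primrec_log.comp (primrec_tag.comp fst)) (primrec_par.comp fst)).and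
    ((primrec_isPfx.comp (primrec_tag.comp fst) (primrec_tag.comp snd)).and
    (primrec_isPfx.comp (primrec_tag.comp (primrec_par.comp fst)) (primrec_tag.comp fst)).not)))

/-- The definition of `Coh P Q`, with the values of `Coh` for smaller arguments taken from a
table. -/
def CohStep (T : List Bool) (P Q : ℕ) : Prop :=
  ∃ m < tgt Q + 1, par^[m] (tgt P) = src P ∧ par^[m] (tgt Q) = src Q ∧
    ∀ t < m, DescentStep (par^[t] (tgt P)) (par^[t] (tgt Q)) ∧
      ∀ R < Q, IsPfx R (tag (par^[t] (tgt Q))) → Decl R → tgt R = par (par^[t] (tgt P)) →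
        ∃ S < Q, IsPfx S (tag (par^[t] (tgt Q))) ∧ R < S ∧ Decl S ∧ T.getD (Nat.pair R S) false = true

theorem primrec_cohStep : PrimrecPred fun p : List Bool × ℕ × ℕ => CohStep p.1 p.2.1 p.2.2 := by
  have hpar {β : Type} [Primcodable β] {f g : β → ℕ} (hf : Primrec f) (hg : Primrec g) :
      Primrec fun b => par^[f b] (g b) := nat_iterate hf hg (primrec_par.comp snd).to₂
  have hP : Primrec fun p : List Bool × ℕ × ℕ => tgt p.2.1 := primrec_tgt.comp (fst.comp snd)
  have hQ : Primrec fun p : List Bool × ℕ × ℕ => tgt p.2.2 := primrec_tgt.comp (snd.comp snd)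
  have hQ' : Primrec fun p : List Bool × ℕ × ℕ => p.2.2 := snd.comp snd
  refine PrimrecPred.bex (succ.comp hQ) ((Primrec.eq.comp (hpar snd (hP.comp fst))
    (primrec_src.comp (fst.comp (snd.comp fst)))).and ((Primrec.eq.comp (hpar snd (hQ.comp fst))
    (primrec_src.comp (snd.comp (snd.comp fst)))).and (PrimrecPred.ball snd ?_)))
  have hP' : Primrec fun p : ((List Bool × ℕ × ℕ) × ℕ) × ℕ => par^[p.2] (tgt p.1.1.2.1) :=
    hpar snd (hP.comp (fst.comp fst))
  have hQt : Primrec fun p : ((List Bool × ℕ × ℕ) × ℕ) × ℕ => par^[p.2] (tgt p.1.1.2.2) :=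
    hpar snd (hQ.comp (fst.comp fst))
  refine (primrec_descentStep.comp hP' hQt).and (PrimrecPred.ball (hQ'.comp (fst.comp fst))
    ((primrec_isPfx.comp snd (primrec_tag.comp (hQt.comp fst))).imp ((primrec_decl.comp snd).imp
    ((Primrec.eq.comp (primrec_tgt.comp snd) (primrec_par.comp (hP'.comp fst))).imp
    (PrimrecPred.bex (hQ'.comp (fst.comp (fst.comp fst)))
    ((primrec_isPfx.comp snd (primrec_tag.comp (hQt.comp (fst.comp fst)))).and
    ((nat_lt.comp (snd.comp fst) snd).and ((primrec_decl.comp snd).and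
    (Primrec.eq.comp ((list_getD false).comp (fst.comp (fst.comp (fst.comp (fst.comp fst))))
      (Primrec₂.natPair.comp (snd.comp fst) snd)) (const true))))))))))

-- Course-of-values recursion on `Nat.pair P Q`: the recursive calls have `R < S < Q`, which makes
-- `Nat.pair R S` smaller.
open Classical in
theorem primrec_coh : PrimrecRel Coh := by
  let f : Unit → ℕ → Bool := fun _ n => decide (Coh n.unpair.1 n.unpair.2)
  have hstep : ∀ n, CohStep ((List.range n).map (f ())) n.unpair.1 n.unpair.2 ↔
      Coh n.unpair.1 n.unpair.2 := by
    intro n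
    have hT : ∀ R S, S < n.unpair.2 → R < S →
        (((List.range n).map (f ())).getD (Nat.pair R S) false = true ↔ Coh R S) := by
      intro R S hS hRS
      have h1 : Nat.pair R S < n := by
        have h2 := Nat.pair_lt_max_add_one_sq R S
        rw [max_eq_right hRS.le] at h2
        have h3 : (S + 1) ^ 2 ≤ n.unpair.2 ^ 2 := Nat.pow_le_pow_left hS 2
        have h4 := Nat.max_sq_add_min_le_pair n.unpair.1 n.unpair.2
        have h5 : n.unpair.2 ^ 2 ≤ (max n.unpair.1 n.unpair.2) ^ 2 :=
          Nat.pow_le_pow_left (le_max_right _ _) 2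
        rw [Nat.pair_unpair] at h4
        omega
      rw [List.getD_eq_getElem _ _ (by simpa using h1)]
      simp [f]
    rw [CohStep, Coh]
    refine exists_congr fun m => and_congr_right fun _ => and_congr_right fun _ =>
      and_congr_right fun _ => forall₂_congr fun t _ => and_congr_right fun _ =>
      forall₂_congr fun R _ => forall₃_congr fun _ _ _ => exists_congr fun S => ?_
    rw [exists_prop]
    refine and_congr_right fun hS => and_congr_right fun _ => and_congr_right fun hRS =>
      and_congr_right fun _ => hT R S hS hRS
  have hg : Primrec₂ fun (_ : Unit) (T : List Bool) =>
      some (decide (CohStep T T.length.unpair.1 T.length.unpair.2)) := by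
    have : PrimrecPred fun T : List Bool => CohStep T T.length.unpair.1 T.length.unpair.2 :=
      (primrec_cohStep.comp (f := fun T : List Bool => (T, T.length.unpair))
        (Primrec.id.pair (unpair.comp list_length))).of_eq fun _ => Iff.rfl
    exact option_some.comp (this.decide.comp snd)
  have hH : ∀ n, decide (CohStep ((List.range n).map (f ())) n.unpair.1 n.unpair.2) = f () n :=
    fun n => decide_eq_decide.2 (hstep n)
  have hf : Primrec₂ f := nat_strong_rec f hg fun _ n => by
    rw [List.length_map, List.length_range]
    exact congrArg some (hH n)
  have : PrimrecPred fun p : ℕ × ℕ => f () (Nat.pair p.1 p.2) = true :=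
    Primrec.eq.comp (hf.comp (const ()) (Primrec₂.natPair.comp fst snd)) (const true)
  exact this.of_eq fun p => by simp [f]

end Primrec

/-! ### Effective analytic sets -/

section Sigma11

open Primrec

theorem mem_baireCylinder_map_range (x : ℕ → ℕ) (N : ℕ) :
    x ∈ baireCylinder ((List.range N).map x) := by
  intro i hi
  simp

theorem getD_of_mem_baireCylinder {s : List ℕ} {x : ℕ → ℕ} (h : x ∈ baireCylinder s) {i : ℕ}
    (hi : i < s.length) : s.getD i 0 = x i := by
  rw [List.getD_eq_getElem _ _ hi, h i hi]

/-- Failure of the instance `m` is visible on initial segments of length `b m`, so the complement is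
a union of boxes with a decidable index set. -/
theorem isSigma11_of_local {C : ℕ × ℕ × ℕ → (ℕ → ℕ) → (ℕ → ℕ) → Prop} {b : ℕ × ℕ × ℕ → ℕ}
    (hb : Primrec b)
    (hC : PrimrecPred fun p : (ℕ × ℕ × ℕ) × List ℕ × List ℕ =>
      C p.1 (fun i => p.2.1.getD i 0) (fun i => p.2.2.getD i 0))
    (hloc : ∀ m x x' y y', (∀ i < b m, x i = x' i) → (∀ i < b m, y i = y' i) → C m x y → C m x' y') :
    IsSigma11 {x | ∃ y, ∀ m, C m x y} := by
  refine ⟨{p | ∀ m, C m p.1 p.2}, ?_, rfl⟩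
  -- The length of the first sequence names the instance to be tested. The ignored second component
  -- of `N` leaves room to choose `N` at least `b m`.
  let d : ℕ → ℕ × ℕ × ℕ := fun N => (N.unpair.1.unpair.1, N.unpair.1.unpair.2.unpair)
  have hd : Primrec d := by
    have h1 : Primrec fun N : ℕ => N.unpair.1.unpair := unpair.comp (fst.comp unpair)
    exact (fst.comp h1).pair (unpair.comp (snd.comp h1))
  have hlen : Primrec fun p : List ℕ × List ℕ => d p.1.length := hd.comp (list_length.comp fst)
  have hW : PrimrecPred fun p : List ℕ × List ℕ => b (d p.1.length) ≤ p.1.length ∧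
      b (d p.1.length) ≤ p.2.length ∧
      ¬ C (d p.1.length) (fun i => p.1.getD i 0) (fun i => p.2.getD i 0) :=
    (nat_le.comp (hb.comp hlen) (list_length.comp fst)).and
      ((nat_le.comp (hb.comp hlen) (list_length.comp snd)).and
        ((hC.comp (f := fun p : List ℕ × List ℕ => (d p.1.length, p)) (hlen.pair .id)).of_eq
          fun _ => Iff.rfl).not)
  obtain ⟨_, hW'⟩ := hW
  refine ⟨_, ComputablePred.to_re ⟨_, hW'.to_comp⟩, ?_⟩
  ext ⟨x, y⟩
  simp only [Set.mem_compl_iff, Set.mem_ofPred_eq, Set.mem_iUnion, Set.mem_prod, not_forall]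
  constructor
  · rintro ⟨m, hm⟩
    let N := Nat.pair (Nat.pair m.1 (Nat.pair m.2.1 m.2.2)) (b m)
    have hN : b m ≤ N := Nat.right_le_pair _ _
    have hdN : d N = m := by simp [d, N]
    refine ⟨((List.range N).map x, (List.range N).map y), ⟨?_, ?_, ?_⟩,
      mem_baireCylinder_map_range _ _, mem_baireCylinder_map_range _ _⟩
    · simpa [hdN] using hN
    · simpa [hdN] using hN
    · simp only [List.length_map, List.length_range, hdN]
      refine fun hc => hm (hloc m _ _ _ _ (fun i hi => ?_) (fun i hi => ?_) hc)
      · exact getD_of_mem_baireCylinder (mem_baireCylinder_map_range x N) (by simp; omega)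
      · exact getD_of_mem_baireCylinder (mem_baireCylinder_map_range y N) (by simp; omega)
  · rintro ⟨⟨s, t⟩, ⟨h1, h2, h3⟩, hx, hy⟩
    refine ⟨d s.length, fun hc => h3 (hloc _ _ _ _ _ (fun i hi => ?_) (fun i hi => ?_) hc)⟩
    · exact (getD_of_mem_baireCylinder hx (hi.trans_le h1)).symm
    · exact (getD_of_mem_baireCylinder hy (hi.trans_le h2)).symm

/-! ### From lightface classes to analytic and Borel sets. -/

theorem isOpen_baireCylinder (s : List ℕ) : IsOpen (baireCylinder s) := by
  have : baireCylinder s = ⋂ i : Fin s.length, {x | x i = s[i]} := by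
    ext x
    simp only [baireCylinder, Set.mem_ofPred_eq, Set.mem_iInter]
    exact ⟨fun h i => h i i.2, fun h i hi => h ⟨i, hi⟩⟩
  rw [this]
  refine isOpen_iInter_of_finite fun i => ?_
  have hc : Continuous fun x : ℕ → ℕ => x i := continuous_apply _
  exact (isOpen_discrete ({s[i]} : Set ℕ)).preimage hc

theorem IsSigma01.isOpen {U : Set ((ℕ → ℕ) × (ℕ → ℕ))} (h : IsSigma01 U) : IsOpen U := by
  obtain ⟨W, -, rfl⟩ := h
  exact isOpen_biUnion fun c _ => (isOpen_baireCylinder _).prod (isOpen_baireCylinder _)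

theorem IsSigma11.analyticSet {A : Set (ℕ → ℕ)} (h : IsSigma11 A) : MeasureTheory.AnalyticSet A := by
  obtain ⟨F, hF, rfl⟩ := h
  have hc : IsClosed F := isOpen_compl_iff.1 hF.isOpen
  have : {x | ∃ y, (x, y) ∈ F} = Prod.fst '' F := by ext; simp
  rw [this]
  exact hc.analyticSet.image_of_continuous continuous_fst

theorem IsDelta11.measurableSet {A : Set (ℕ → ℕ)} (h : IsDelta11 A) :
    @MeasurableSet (ℕ → ℕ) (borel (ℕ → ℕ)) A := by
  let _ : MeasurableSpace (ℕ → ℕ) := borel _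
  have _ : BorelSpace (ℕ → ℕ) := ⟨rfl⟩
  exact h.1.analyticSet.measurableSet_of_compl (IsSigma11.analyticSet h.2)

/-! ### Definability of the group -/

/-- One instance of the condition that `F` codes a sequence of branches, their realizations, the
partial products of these, and witnesses for the declared pairs that are not sites. -/
structure WordCond (F : ℕ → ℕ → ℕ → ℕ) (j n u : ℕ) : Prop where
  root : F 0 j 0 = 1
  branch : F 0 j (n + 1) / 2 = F 0 j n
  invol : F 1 j n = u → F 1 j u = n
  killed : Decl (F 0 j (2 * n + 2)) → F 1 j n.unpair.1 = n.unpair.2 ∨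
    (F 3 j n = u → 2 * n + 2 < u ∧ Decl (F 0 j u) ∧ Coh (F 0 j (2 * n + 2)) (F 0 j u))
  site : Decl (F 0 j (2 * n + 2)) → F 1 j n.unpair.1 = n.unpair.2 → 2 * n + 2 < u →
    Decl (F 0 j u) → ¬ Coh (F 0 j (2 * n + 2)) (F 0 j u)
  cases : F 1 j n = u → Decl (F 0 j (2 * Nat.pair n u + 2)) ∨ Decl (F 0 j (2 * Nat.pair u n + 2)) ∨
    u = 2 * Nat.pair n (F 0 j n) + 1 ∨ n = 2 * Nat.pair u (F 0 j u) + 1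
  start : F 2 0 n = n
  step : F 2 j n = u → F 2 (j + 1) n = F 1 j u

/-- `killed` and `site` together force stream 1 to realize exactly the sites, and `Gen.unique` then
identifies it with `mate`. Nested values are reached through the variable `u`, which keeps every
instance local. -/
theorem WordCond.exists_branches {F : ℕ → ℕ → ℕ → ℕ} (h : ∀ j n u, WordCond F j n u) :
    ∃ a : ℕ → Branch, ∀ j n, F 2 j n = wordProd ((List.range j).map a).reverse n := by
  let a : ℕ → Branch := fun j => ⟨F 0 j, (h j 0 0).root, fun n => (h j n 0).branch⟩
  have hinv : ∀ j n, F 1 j (F 1 j n) = n := fun j n => (h j n _).invol rfl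
  have hsite : ∀ j x y, DeclOn (a j) x y → F 1 j x = y → Site (a j) x y := fun j x y hd hg =>
    ⟨hd, fun n hn hdn => (h j (Nat.pair x y) n).site hd (by simpa using hg) hn hdn⟩
  have hgen : ∀ j, Gen (a j) (F 1 j) := fun j => by
    refine ⟨hinv j, fun x y hs => ?_, fun x => ?_⟩
    · rcases (h j (Nat.pair x y) _).killed hs.1 with h1 | h1
      · simpa using h1
      · obtain ⟨h2, h3, h4⟩ := h1 rfl
        exact absurd h4 (hs.2 _ h2 h3)
    · rcases (h j x _).cases rfl with h1 | h1 | h1 | h1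
      · exact .inl (hsite j _ _ h1 rfl)
      · exact .inr (.inl (hsite j _ _ h1 (hinv j x)))
      · exact .inr (.inr (.inl h1))
      · exact .inr (.inr (.inr h1))
  refine ⟨a, fun j n => ?_⟩
  induction j with
  | zero => rw [(h 0 n 0).start]; simp
  | succ j ih =>
    rw [(h j n _).step rfl, ih, (hgen j).unique (gen_mate (a j))]
    simp [List.range_succ]

theorem exists_wordCond (a : ℕ → Branch) :
    ∃ κ : ℕ → ℕ → ℕ, ∀ F : ℕ → ℕ → ℕ → ℕ, (∀ j n, F 0 j n = a j n) → (∀ j n, F 1 j n = mate (a j) n) →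
      (∀ j n, F 2 j n = wordProd ((List.range j).map a).reverse n) → (∀ j n, F 3 j n = κ j n) →
      ∀ j n u, WordCond F j n u := by
  have hk : ∀ j n, ∃ q, Decl (a j (2 * n + 2)) → mate (a j) n.unpair.1 = n.unpair.2 ∨
      (2 * n + 2 < q ∧ Decl (a j q) ∧ Coh (a j (2 * n + 2)) (a j q)) := by
    intro j n
    by_cases hs : Site (a j) n.unpair.1 n.unpair.2
    · exact ⟨0, fun _ => .inl ((gen_mate (a j)).site _ _ hs)⟩
    · rw [Site, DeclOn, Nat.pair_unpair] at hs
      by_cases hd : Decl (a j (2 * n + 2))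
      · by_contra! hc
        exact hs ⟨hd, fun q hq hdq hcoh => (hc q).2.2 hq hdq hcoh⟩
      · exact ⟨0, fun h => absurd h hd⟩
  choose κ hκ using hk
  refine ⟨κ, fun F h0 h1 h2 h3 j n u => ⟨?_, ?_, ?_, ?_, ?_, ?_, ?_, ?_⟩⟩
  · rw [h0]; exact (a j).val_zero
  · rw [h0, h0]; exact (a j).val_succ n
  · rw [h1, h1]
    rintro rfl
    exact mate_mate _ _
  · rw [h0, h0, h1, h3]
    intro hd
    rcases hκ j n hd with h | h
    · exact .inl h
    · exact .inr fun hu => hu ▸ h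
  · rw [h0, h0, h1]
    intro hd hm hq hdq hc
    set x := n.unpair.1 with hx
    set y := n.unpair.2 with hy
    have hn : n = Nat.pair x y := (Nat.pair_unpair n).symm
    rw [hn] at hd hq hc
    -- A declared pair that is matched must be a site: its endpoints meet no other declared pair,
    -- and neither is a child along the branch.
    have hs : Site (a j) x y := by
      have hd' : DeclOn (a j) x y := hd
      have := (gen_mate (a j)).cases x
      rw [hm] at this
      rcases this with h | h | h | h
      · exact h
      · have := hd'.eq_of_meet h.1 (.inr (.inl rfl))
        exact absurd this.1 hd'.ne
      · exact absurd h (hd'.tgt_ne_child x)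
      · exact absurd h (hd'.src_ne_child _ y)
    exact hs.2 u hq hdq hc
  · rw [h0, h0, h0, h0, h1]
    rintro rfl
    rcases (gen_mate (a j)).cases n with h | h | h | h
    · exact .inl h.1
    · exact .inr (.inl h.1)
    · exact .inr (.inr (.inl h))
    · exact .inr (.inr (.inr h))
  · rw [h2]; simp
  · rw [h2, h2, h1]
    rintro rfl
    simp [List.range_succ]

/-- The streams coded by a real. -/
def stream (y : ℕ → ℕ) (c j n : ℕ) : ℕ := y (5 * Nat.pair j n + c + 1)

theorem exists_stream (k : ℕ) (f : ℕ → ℕ → ℕ → ℕ) :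
    ∃ y : ℕ → ℕ, y 0 = k ∧ ∀ c < 5, ∀ j n, stream y c j n = f c j n := by
  refine ⟨fun i => if i = 0 then k else
    f ((i - 1) % 5) ((i - 1) / 5).unpair.1 ((i - 1) / 5).unpair.2, rfl, fun c hc j n => ?_⟩
  have h1 : (5 * Nat.pair j n + c + 1 - 1) % 5 = c := by omega
  have h2 : (5 * Nat.pair j n + c + 1 - 1) / 5 = Nat.pair j n := by omega
  simp only [stream, h1, h2, Nat.unpair_pair]
  simp

/-- A condition on `x` and `y` which says that `y` codes a word whose product is `x`. -/
def MemCond (m : ℕ × ℕ × ℕ) (x y : ℕ → ℕ) : Prop :=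
  WordCond (stream y) m.1 m.2.1 m.2.2 ∧ (y 0 = m.1 → stream y 2 m.1 m.2.1 = x m.2.1)

/-- A condition on `x` and `y` which says that `y` codes a proof that `x` is not a permutation,
or a word whose product differs from `x` but agrees with it infinitely often. -/
def NotMemCond (m : ℕ × ℕ × ℕ) (x y : ℕ → ℕ) : Prop :=
  WordCond (stream y) m.1 m.2.1 m.2.2 ∧
  (y 0 = 0 → stream y 4 0 0 = m.2.1 → stream y 4 0 1 = m.2.2 → m.2.1 ≠ m.2.2 ∧ x m.2.1 = x m.2.2) ∧
  (y 0 = 1 → stream y 4 0 0 = m.2.2 → x m.2.1 ≠ m.2.2) ∧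
  (y 0 = m.1 + 2 → stream y 4 0 m.2.1 = m.2.2 → m.2.1 ≤ m.2.2 ∧ stream y 2 m.1 m.2.2 = x m.2.2) ∧
  (y 0 = m.1 + 2 → stream y 4 1 0 = m.2.2 → stream y 2 m.1 m.2.2 ≠ x m.2.2)

theorem range_map_getD (L : List Branch) (b : Branch) :
    (List.range L.length).map (fun j => L.getD j b) = L := by
  refine List.ext_getElem (by simp) fun r h1 h2 => ?_
  simp [List.getElem?_eq_getElem h2]

theorem exists_wordProd_eq (L : List Branch) :
    ∃ (a : ℕ → Branch) (k : ℕ), wordProd ((List.range k).map a).reverse = wordProd L :=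
  ⟨fun j => L.reverse.getD j (Branch.through 1 one_pos), L.reverse.length, by
    rw [range_map_getD, List.reverse_reverse]⟩

theorem exists_code (a : ℕ → Branch) (k : ℕ) (w : ℕ → ℕ → ℕ) :
    ∃ y : ℕ → ℕ, y 0 = k ∧ (∀ j n u, WordCond (stream y) j n u) ∧
      (∀ j n, stream y 2 j n = wordProd ((List.range j).map a).reverse n) ∧
      ∀ j n, stream y 4 j n = w j n := by
  obtain ⟨κ, hκ⟩ := exists_wordCond a
  -- Stream 4 stays free for the witnesses of non-membership.
  obtain ⟨y, hy, hf⟩ := exists_stream k fun c j n =>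
    if c = 0 then a j n else if c = 1 then mate (a j) n else
    if c = 2 then wordProd ((List.range j).map a).reverse n else if c = 3 then κ j n else w j n
  have h2 : ∀ j n, stream y 2 j n = wordProd ((List.range j).map a).reverse n := fun j n => by
    rw [hf 2 (by norm_num)]; simp
  refine ⟨y, hy, hκ _ (fun j n => ?_) (fun j n => ?_) h2 (fun j n => ?_), h2, fun j n => ?_⟩
  · rw [hf 0 (by norm_num)]; simp
  · rw [hf 1 (by norm_num)]; simp
  · rw [hf 3 (by norm_num)]; simp
  · rw [hf 4 (by norm_num)]; simp

theorem mem_baireSet_iff (x : ℕ → ℕ) :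
    x ∈ baireSet genGroup ↔ ∃ y, ∀ m, MemCond m x y := by
  constructor
  · rintro ⟨g, hg, hx⟩
    obtain ⟨L, rfl⟩ := mem_genGroup.1 hg
    obtain ⟨a, k, hL⟩ := exists_wordProd_eq L
    obtain ⟨y, hy, hw, h2, -⟩ := exists_code a k fun _ _ => 0
    refine ⟨y, fun m => ⟨hw _ _ _, fun hk => ?_⟩⟩
    rw [h2, ← hk, hy, hL, hx]
  · rintro ⟨y, hy⟩
    obtain ⟨a, ha⟩ := WordCond.exists_branches (F := stream y) fun j n u => (hy (j, n, u)).1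
    refine ⟨wordProd ((List.range (y 0)).map a).reverse, mem_genGroup.2 ⟨_, rfl⟩, fun n => ?_⟩
    exact ((hy (y 0, n, 0)).2 rfl).symm.trans (ha (y 0) n)

/-- The value `y 0` selects the reason: `0` for a failure of injectivity, `1` for a missed value, `k
+ 2` for a word of length `k`. In the last case, were `x` in the group, the quotient of the two
elements would be a non-identity element with infinitely many fixed points. -/
theorem notMem_baireSet_iff (x : ℕ → ℕ) :
    x ∈ (baireSet genGroup)ᶜ ↔ ∃ y, ∀ m, NotMemCond m x y := by
  let a₀ : ℕ → Branch := fun _ => Branch.through 1 one_pos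
  constructor
  · intro hx
    by_cases hi : Function.Injective x
    swap
    · rw [Function.not_injective_iff] at hi
      obtain ⟨p, q, hpq, hne⟩ := hi
      obtain ⟨y, hy, hw, -, h4⟩ := exists_code a₀ 0 fun _ n => if n = 0 then p else q
      refine ⟨y, fun m => ⟨hw _ _ _, fun _ h5 h6 => ?_, by omega, by omega, by omega⟩⟩
      simp only [h4] at h5 h6
      simp only [if_true, one_ne_zero, if_false] at h5 h6
      subst h5
      rw [← h6]
      exact ⟨hne, hpq⟩
    by_cases hs : Function.Surjective x
    swap
    · obtain ⟨p, hp⟩ : ∃ p, ∀ n, x n ≠ p := by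
        by_contra! hc; exact hs hc
      obtain ⟨y, hy, hw, -, h4⟩ := exists_code a₀ 1 fun _ _ => p
      refine ⟨y, fun m => ⟨hw _ _ _, by omega, fun _ h5 => ?_, by omega, by omega⟩⟩
      rw [h4] at h5
      exact h5 ▸ hp _
    let h : Equiv.Perm ℕ := Equiv.ofBijective x ⟨hi, hs⟩
    obtain ⟨g, hg, hinf⟩ := exists_agreement h
    have hne : ∃ n, g n ≠ x n := by
      by_contra! hc
      exact hx ⟨g, hg, fun n => (hc n).symm⟩
    obtain ⟨p, hp⟩ := hne
    have hag : ∀ n, ∃ w, n ≤ w ∧ g w = x w := fun n => by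
      obtain ⟨w, hw, hlt⟩ := hinf.exists_gt n
      exact ⟨w, hlt.le, hw⟩
    choose w hw hw' using hag
    obtain ⟨L, rfl⟩ := mem_genGroup.1 hg
    obtain ⟨a, k, hL⟩ := exists_wordProd_eq L
    obtain ⟨y, hy, hwc, h2, h4⟩ := exists_code a (k + 2) fun j n => if j = 0 then w n else p
    refine ⟨y, fun m => ⟨hwc _ _ _, by omega, by omega, fun hk h5 => ?_, fun hk h5 => ?_⟩⟩
    · obtain rfl : k = m.1 := by omega
      rw [h4, if_pos rfl] at h5
      rw [h2, hL, ← h5]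
      exact ⟨hw _, hw' _⟩
    · obtain rfl : k = m.1 := by omega
      rw [h4, if_neg one_ne_zero] at h5
      rw [h2, hL, ← h5]
      exact hp
  · rintro ⟨y, hy⟩ ⟨g, hg, hx⟩
    obtain ⟨a, ha⟩ := WordCond.exists_branches (F := stream y) fun j n u => (hy (j, n, u)).1
    obtain rfl : x = g := funext hx
    rcases hk : y 0 with _ | _ | k
    · obtain ⟨h1, h2⟩ := (hy (0, _, _)).2.1 hk rfl rfl
      exact h1 (g.injective h2)
    · obtain ⟨n, hn⟩ := g.surjective (stream y 4 0 0)
      exact (hy (0, n, _)).2.2.1 hk rfl hn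
    · set p := wordProd ((List.range k).map a).reverse with hp
      have h3 : ∀ n, n ≤ stream y 4 0 n ∧ p (stream y 4 0 n) = g (stream y 4 0 n) := fun n => by
        have := (hy (k, n, stream y 4 0 n)).2.2.2.1 hk rfl
        rw [ha] at this
        exact this
      have h4 : p (stream y 4 1 0) ≠ g (stream y 4 1 0) := by
        have := (hy (k, 0, stream y 4 1 0)).2.2.2.2 hk rfl
        rw [ha] at this
        exact this
      have hpg : p ∈ genGroup := mem_genGroup.2 ⟨_, rfl⟩
      have hne : p⁻¹ * g ≠ 1 := fun h => h4 (by rw [inv_mul_eq_one.1 h])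
      have hfin := isCofinitary_genGroup _ (mul_mem (inv_mem hpg) hg) hne
      obtain ⟨N, hN⟩ := hfin.bddAbove
      obtain ⟨h5, h6⟩ := h3 (N + 1)
      have h7 := hN (a := stream y 4 0 (N + 1)) (by
        simp only [Set.mem_ofPred_eq, Equiv.Perm.mul_apply]
        rw [← h6]; simp)
      omega

/-! ### Effectivity and locality of the membership conditions. -/

open Primrec

theorem primrec_wordCond {β : Type*} [Primcodable β] {F : β → ℕ → ℕ → ℕ → ℕ} {j n u : β → ℕ}
    (hF : ∀ c {f g : β → ℕ}, Primrec f → Primrec g → Primrec fun b => F b c (f b) (g b))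
    (hj : Primrec j) (hn : Primrec n) (hu : Primrec u) :
    PrimrecPred fun b => WordCond (F b) (j b) (n b) (u b) := by
  have hlin {f : β → ℕ} (hf : Primrec f) (c : ℕ) : Primrec fun b => 2 * f b + c :=
    nat_add.comp (nat_mul.comp (const 2) hf) (const c)
  have hP := hF 0 hj (hlin hn 2)
  have h1 := unpair.comp hn
  have heq {f g : β → ℕ} (hf : Primrec f) (hg : Primrec g) : PrimrecPred fun b => f b = g b :=
    Primrec.eq.comp hf hg
  have hm := heq (hF 1 hj (fst.comp h1)) (snd.comp h1)
  have hu0 := hF 0 hj hu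
  have hg := heq (hF 1 hj hn) hu
  refine ((heq (hF 0 hj (const 0)) (const 1)).and
    ((heq (nat_div.comp (hF 0 hj (succ.comp hn)) (const 2)) (hF 0 hj hn)).and
    ((hg.imp (heq (hF 1 hj hu) hn)).and
    (((primrec_decl.comp hP).imp (hm.or ((heq (hF 3 hj hn) hu).imp
      ((nat_lt.comp (hlin hn 2) hu).and ((primrec_decl.comp hu0).and (primrec_coh.comp hP hu0)))))).and
    (((primrec_decl.comp hP).imp (hm.imp ((nat_lt.comp (hlin hn 2) hu).imp
      ((primrec_decl.comp hu0).imp (primrec_coh.comp hP hu0).not)))).and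
    ((hg.imp ((primrec_decl.comp (hF 0 hj (hlin (Primrec₂.natPair.comp hn hu) 2))).or
      ((primrec_decl.comp (hF 0 hj (hlin (Primrec₂.natPair.comp hu hn) 2))).or
      ((heq hu (hlin (Primrec₂.natPair.comp hn (hF 0 hj hn)) 1)).or
      (heq hn (hlin (Primrec₂.natPair.comp hu hu0) 1)))))).and
    ((heq (hF 2 (const 0) hn) hn).and
    ((heq (hF 2 hj hn) hu).imp (heq (hF 2 (succ.comp hj) hn) (hF 1 hj hu)))))))))).of_eq fun b => ?_
  exact ⟨fun ⟨h1, h2, h3, h4, h5, h6, h7, h8⟩ => ⟨h1, h2, h3, h4, h5, h6, h7, h8⟩,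
    fun ⟨h1, h2, h3, h4, h5, h6, h7, h8⟩ => ⟨h1, h2, h3, h4, h5, h6, h7, h8⟩⟩

/-- A bound for the second index of all values of the streams that occur in a condition. -/
def streamBound (n u : ℕ) : ℕ := 2 * (Nat.pair n u + Nat.pair u n) + n + n + u + 2

/-- A bound for all places at which a condition reads its arguments. -/
def readBound (m : ℕ × ℕ × ℕ) : ℕ := 5 * Nat.pair (m.1 + 1) (streamBound m.2.1 m.2.2) + 6

theorem primrec_readBound : Primrec readBound := by
  have hn : Primrec fun m : ℕ × ℕ × ℕ => m.2.1 := fst.comp snd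
  have hu : Primrec fun m : ℕ × ℕ × ℕ => m.2.2 := snd.comp snd
  have h2 := nat_mul.comp (const 2) (nat_add.comp (Primrec₂.natPair.comp hn hu)
    (Primrec₂.natPair.comp hu hn))
  have h3 := nat_add.comp (nat_add.comp (nat_add.comp (nat_add.comp h2 hn) hn) hu) (const 2)
  exact nat_add.comp (nat_mul.comp (const 5) (Primrec₂.natPair.comp (succ.comp fst) h3)) (const 6)

theorem WordCond.congr {F F' : ℕ → ℕ → ℕ → ℕ} {j n u : ℕ}
    (hF : ∀ c < 5, ∀ j' ≤ j + 1, ∀ n' ≤ streamBound n u, F c j' n' = F' c j' n')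
    (h : WordCond F j n u) : WordCond F' j n u := by
  have e : ∀ c < 5, ∀ n' ≤ streamBound n u, F c j n' = F' c j n' := fun c hc => hF c hc j (by omega)
  have p1 := Nat.unpair_left_le n
  have b0 : 0 ≤ streamBound n u := Nat.zero_le _
  have b1 : n ≤ streamBound n u := by unfold streamBound; omega
  have b2 : n + 1 ≤ streamBound n u := by unfold streamBound; omega
  have b3 : u ≤ streamBound n u := by unfold streamBound; omega
  have b4 : 2 * n + 2 ≤ streamBound n u := by unfold streamBound; omega
  have b5 : n.unpair.1 ≤ streamBound n u := p1.trans b1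
  have b6 : 2 * Nat.pair n u + 2 ≤ streamBound n u := by unfold streamBound; omega
  have b7 : 2 * Nat.pair u n + 2 ≤ streamBound n u := by unfold streamBound; omega
  obtain ⟨h1, h2, h3, h4, h5, h6, h7, h8⟩ := h
  rw [e 0 (by norm_num) _ b0] at h1
  rw [e 0 (by norm_num) _ b1, e 0 (by norm_num) _ b2] at h2
  rw [e 1 (by norm_num) _ b1, e 1 (by norm_num) _ b3] at h3
  rw [e 0 (by norm_num) _ b4, e 0 (by norm_num) _ b3, e 1 (by norm_num) _ b5,
    e 3 (by norm_num) _ b1] at h4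
  rw [e 0 (by norm_num) _ b4, e 0 (by norm_num) _ b3, e 1 (by norm_num) _ b5] at h5
  rw [e 0 (by norm_num) _ b1, e 0 (by norm_num) _ b3, e 0 (by norm_num) _ b6,
    e 0 (by norm_num) _ b7, e 1 (by norm_num) _ b1] at h6
  rw [hF 2 (by norm_num) 0 (by omega) _ b1] at h7
  rw [e 2 (by norm_num) _ b1, hF 2 (by norm_num) _ le_rfl _ b1, e 1 (by norm_num) _ b3] at h8
  exact ⟨h1, h2, h3, h4, h5, h6, h7, h8⟩

theorem stream_congr {m : ℕ × ℕ × ℕ} {y y' : ℕ → ℕ} (h : ∀ i < readBound m, y i = y' i) :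
    ∀ c < 5, ∀ j' ≤ m.1 + 1, ∀ n' ≤ streamBound m.2.1 m.2.2, stream y c j' n' = stream y' c j' n' :=
  fun c hc j' hj n' hn => h _ (by
    have := pair_le_pair hj hn
    unfold readBound
    omega)

theorem lt_readBound {m : ℕ × ℕ × ℕ} {i : ℕ} (h : i ≤ streamBound m.2.1 m.2.2) : i < readBound m := by
  have := Nat.right_le_pair (m.1 + 1) (streamBound m.2.1 m.2.2)
  unfold readBound
  omega

section

variable {m : ℕ × ℕ × ℕ} {x x' y y' : ℕ → ℕ}

theorem MemCond.congr (h : MemCond m x y) (hx : ∀ i < readBound m, x i = x' i)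
    (hy : ∀ i < readBound m, y i = y' i) : MemCond m x' y' := by
  have b1 : m.2.1 ≤ streamBound m.2.1 m.2.2 := by unfold streamBound; omega
  have e := stream_congr hy
  obtain ⟨h1, h2⟩ := h
  refine ⟨h1.congr e, ?_⟩
  rw [hy 0 (lt_readBound (Nat.zero_le _)), e 2 (by norm_num) _ (by omega) _ b1,
    hx _ (lt_readBound b1)] at h2
  exact h2

theorem NotMemCond.congr (h : NotMemCond m x y) (hx : ∀ i < readBound m, x i = x' i)
    (hy : ∀ i < readBound m, y i = y' i) : NotMemCond m x' y' := by
  have b0 : 0 ≤ streamBound m.2.1 m.2.2 := Nat.zero_le _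
  have b1 : m.2.1 ≤ streamBound m.2.1 m.2.2 := by unfold streamBound; omega
  have b2 : m.2.2 ≤ streamBound m.2.1 m.2.2 := by unfold streamBound; omega
  have b3 : 1 ≤ streamBound m.2.1 m.2.2 := by unfold streamBound; omega
  have e := stream_congr hy
  obtain ⟨h1, h2, h3, h4, h5⟩ := h
  have ey := hy 0 (lt_readBound b0)
  have ex := hx _ (lt_readBound b1)
  have ex' := hx _ (lt_readBound b2)
  rw [ey, ex, ex', e 4 (by norm_num) 0 (by omega) _ b0, e 4 (by norm_num) 0 (by omega) _ b3] at h2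
  rw [ey, ex, e 4 (by norm_num) 0 (by omega) _ b0] at h3
  rw [ey, ex', e 4 (by norm_num) 0 (by omega) _ b1, e 2 (by norm_num) _ (by omega) _ b2] at h4
  rw [ey, ex', e 4 (by norm_num) 1 (by omega) _ b0, e 2 (by norm_num) _ (by omega) _ b2] at h5
  exact ⟨h1.congr e, h2, h3, h4, h5⟩

end

section

variable {β : Type*} [Primcodable β]

theorem primrec_getD {t : β → List ℕ} {i : β → ℕ} (ht : Primrec t) (hi : Primrec i) :
    Primrec fun b => (t b).getD (i b) 0 := (list_getD 0).comp ht hi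

theorem primrec_stream {t : β → List ℕ} (ht : Primrec t) (c : ℕ) {f g : β → ℕ} (hf : Primrec f)
    (hg : Primrec g) : Primrec fun b => stream (fun i => (t b).getD i 0) c (f b) (g b) :=
  primrec_getD ht (succ.comp (nat_add.comp (nat_mul.comp (const 5) (Primrec₂.natPair.comp hf hg))
    (const c)))

end

theorem isSigma11_baireSet_genGroup : IsSigma11 (baireSet genGroup) := by
  have : baireSet genGroup = {x | ∃ y, ∀ m, MemCond m x y} := Set.ext mem_baireSet_iff
  rw [this]
  refine isSigma11_of_local primrec_readBound ?_ fun m x x' y y' hx hy h => h.congr hx hy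
  have ht : Primrec fun p : (ℕ × ℕ × ℕ) × List ℕ × List ℕ => p.2.2 := snd.comp snd
  have hj : Primrec fun p : (ℕ × ℕ × ℕ) × List ℕ × List ℕ => p.1.1 := fst.comp fst
  have hn : Primrec fun p : (ℕ × ℕ × ℕ) × List ℕ × List ℕ => p.1.2.1 := fst.comp (snd.comp fst)
  have hu : Primrec fun p : (ℕ × ℕ × ℕ) × List ℕ × List ℕ => p.1.2.2 := snd.comp (snd.comp fst)
  exact (primrec_wordCond (fun c {_ _} => primrec_stream ht c) hj hn hu).and
    ((Primrec.eq.comp (primrec_getD ht (const 0)) hj).imp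
      (Primrec.eq.comp (primrec_stream ht 2 hj hn) (primrec_getD (fst.comp snd) hn)))

theorem isSigma11_compl_baireSet_genGroup : IsSigma11 (baireSet genGroup)ᶜ := by
  have : (baireSet genGroup)ᶜ = {x | ∃ y, ∀ m, NotMemCond m x y} := Set.ext notMem_baireSet_iff
  rw [this]
  refine isSigma11_of_local primrec_readBound ?_ fun m x x' y y' hx hy h => h.congr hx hy
  have hs : Primrec fun p : (ℕ × ℕ × ℕ) × List ℕ × List ℕ => p.2.1 := fst.comp snd
  have ht : Primrec fun p : (ℕ × ℕ × ℕ) × List ℕ × List ℕ => p.2.2 := snd.comp snd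
  have hj : Primrec fun p : (ℕ × ℕ × ℕ) × List ℕ × List ℕ => p.1.1 := fst.comp fst
  have hn : Primrec fun p : (ℕ × ℕ × ℕ) × List ℕ × List ℕ => p.1.2.1 := fst.comp (snd.comp fst)
  have hu : Primrec fun p : (ℕ × ℕ × ℕ) × List ℕ × List ℕ => p.1.2.2 := snd.comp (snd.comp fst)
  have h0 := primrec_getD ht (const 0)
  have hxn := primrec_getD hs hn
  have hxu := primrec_getD hs hu
  have hHu := primrec_stream ht 2 hj hu
  have hj2 := Primrec.eq.comp h0 (succ.comp (succ.comp hj))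
  exact (primrec_wordCond (fun c {_ _} => primrec_stream ht c) hj hn hu).and
    (((Primrec.eq.comp h0 (const 0)).imp
      ((Primrec.eq.comp (primrec_stream ht 4 (const 0) (const 0)) hn).imp
      ((Primrec.eq.comp (primrec_stream ht 4 (const 0) (const 1)) hu).imp
      ((Primrec.eq.comp hn hu).not.and (Primrec.eq.comp hxn hxu))))).and
    (((Primrec.eq.comp h0 (const 1)).imp
      ((Primrec.eq.comp (primrec_stream ht 4 (const 0) (const 0)) hu).imp
      (Primrec.eq.comp hxn hu).not)).and
    ((hj2.imp ((Primrec.eq.comp (primrec_stream ht 4 (const 0) hn) hu).imp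
      ((nat_le.comp hn hu).and (Primrec.eq.comp hHu hxu)))).and
    (hj2.imp ((Primrec.eq.comp (primrec_stream ht 4 (const 1) (const 0)) hu).imp
      (Primrec.eq.comp hHu hxu).not)))))

theorem isDelta11_baireSet_genGroup : IsDelta11 (baireSet genGroup) :=
  ⟨isSigma11_baireSet_genGroup, isSigma11_compl_baireSet_genGroup⟩

end Sigma11

theorem theoremt :
    ∃ G : Subgroup (Equiv.Perm ℕ), IsMaximalCofinitary G ∧
      @MeasurableSet (ℕ → ℕ) (borel (ℕ → ℕ)) (baireSet G) ∧ IsDelta11 (baireSet G) :=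
  ⟨genGroup, isMaximalCofinitary_genGroup, isDelta11_baireSet_genGroup.measurableSet,
    isDelta11_baireSet_genGroup⟩
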